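/- Setting. Let $(G,I,O)$ be a finite open graph with a g-flow $(g,\prec)$ and a measurement order compatible with $\prec$, all public; let $M=V\setminus O$ be the set of measured nodes. A computation is a choice of angles $\varphi\in\{k\pi/4: k=0,\dots,7\}^{M}$. Its correct result is the state of the output qubits after running the measurement pattern on the graph state $|G\rangle$, with the corrected angles $\varphi'_w=(-1)^{s_X}\varphi_w+s_Z\pi$, where $s_X=\sum_{j:\,w\in g(j)}s_j$ and $s_Z=\sum_{j\ne w:\,w\in \mathrm{Odd}(g(j))}s_j$, and with the Pauli corrections $X^{s_X}Z^{s_Z}$ on the outputs. Put $|+_\theta\rangle=\frac1{\sqrt2}(|0\rangle+e^{i\theta}|1\rangle)$. Consider the following UBQC protocol with a server-side operation. Fix a set $S\subseteq M$, an integer $k\ge 0$, and a quantum channel (CPTP map) $\Lambda_S$ from $k$ qubits to the qubits of the nodes in $S$; $\Lambda_S$ is public. A private random value $\omega$ of the client (finitely many values, arbitrary distribution) determines angles $\theta_1,\dots,\theta_k$, a state $\tau$ of the $|M\setminus S|$ qubits of the other measured nodes, and secret angles $(\alpha_v)_{v\in M}$. The client sends $|+_{\theta_1}\rangle\otimes\dots\otimes|+_{\theta_k}\rangle\otimes\tau$.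 The honest server applies $\Lambda_S$ to the $k$ resource qubits, uses the resulting state on the nodes of $S$ and $\tau$ on $M\setminus S$, puts $|+\rangle$ on the output nodes, and applies $CZ$ along all edges. Then, node after node, the client announces $\delta_v=\varphi'_v+\alpha_v+r_v\pi$, with independent uniform secret bits $r_v$; the server measures $v$ in the basis $|\pm_{\delta_v}\rangle$ and returns the outcome $b_v$, which the client decodes as $s_v=b_v\oplus r_v$. Finally the server returns the output qubits, which the client corrects. The protocol is complete if, with the honest server and for every $\varphi$, the client's output state (averaged over all randomness) is the correct result. It is blind if, for every server strategy (an arbitrary channel on the received qubits, followed in each round by an arbitrary quantum instrument that depends on the past transcript and the newly announced angle and whose outcome is the answer), the joint description of the transcript and of the server's quantum memory does not depend on $\varphi$. Proposition. (i) If $|S|\ge 2$, there are no channel $\Lambda_S$ from one qubit to the nodes of $S$, mapping a single resource state $|+_\theta\rangle$ to a state used on the nodes of $S$, and no choice of the client's random data as above (with $k=1$), such that the protocol is both complete and blind. (ii) In particular, no server-side process reduces the quantum communication: for all $S$, $k$, $\Lambda_S$ and client data as above, if the protocol is complete and blind, then the number of qubits sent by the client satisfies $k+|M\setminus S|\ge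 |M|$. -/

import Mathlib

/-! ## Finite registers of qubits, quantum operations -/

namespace UBQC

open scoped ComplexOrder

universe u

/-- Labels of the computational basis of a register of qubits indexed by `ι`. -/
abbrev Reg (ι : Type*) := ι → Fin 2

/-- Operators on the Hilbert space with orthonormal basis `a`. -/
abbrev Op (a : Type*) := Matrix a a ℂ

/-- The rank-one operator `|ψ⟩⟨ψ|`. -/
def proj {a : Type*} (ψ : a → ℂ) : Op a := Matrix.vecMulVec ψ (star ψ)

/-- Tensor product of single-qubit vectors. -/
noncomputable def prodKet {ι : Type*} [Fintype ι] (κ : ι → Fin 2 → ℂ) : Reg ι → ℂ :=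
  fun x => ∏ i, κ i (x i)

/-- `|+_θ⟩ = (|0⟩ + e^{iθ}|1⟩)/√2` for `b = false`, and
`|-_θ⟩ = (|0⟩ - e^{iθ}|1⟩)/√2` for `b = true`. Angles are taken modulo `2π`. -/
noncomputable def ketXY (θ : Real.Angle) (b : Bool) : Fin 2 → ℂ :=
  ![((Real.sqrt 2)⁻¹ : ℂ),
    ((Real.sqrt 2)⁻¹ : ℂ) * (if b then -1 else 1) * (θ.toCircle : ℂ)]

/-- The resource state `|+_θ⟩`. -/
noncomputable def ketPlus (θ : Real.Angle) : Fin 2 → ℂ := ketXY θ false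

/-- A density operator. -/
def IsState {a : Type*} [Fintype a] (ρ : Op a) : Prop := ρ.PosSemidef ∧ ρ.trace = 1

/-- Complete positivity: all the ampliations `id_m ⊗ Λ` preserve positivity. -/
def IsCompletelyPositive {a b : Type*} (Λ : Op a →ₗ[ℂ] Op b) : Prop :=
  ∀ (m : ℕ) (X : Op (Fin m × a)), X.PosSemidef →
    (Matrix.of fun i j : Fin m × b =>
      Λ (Matrix.of fun s t => X (i.1, s) (j.1, t)) i.2 j.2).PosSemidef

/-- A quantum channel: a completely positive and trace preserving map. -/
def IsChannel {a b : Type*} [Fintype a] [Fintype b] (Λ : Op a →ₗ[ℂ] Op b) : Prop :=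
  IsCompletelyPositive Λ ∧ ∀ X, (Λ X).trace = X.trace

/-! ## Measurement patterns -/

/-- An open graph `(G, I, O)`. -/
structure OpenGraph (V : Type u) where
  graph : SimpleGraph V
  input : Finset V
  output : Finset V

/-- The non-output nodes, which are the nodes that get measured. -/
abbrev OpenGraph.Measured {V : Type u} (Γ : OpenGraph V) : Type u := {v : V // v ∉ Γ.output}

/-- The output nodes. -/
abbrev OpenGraph.Out {V : Type u} (Γ : OpenGraph V) : Type u := {v : V // v ∈ Γ.output}

open scoped Classical in
/-- The odd neighbourhood `Odd(K) = {u : |N(u) ∩ K| odd}`. -/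
noncomputable def oddNbhd {V : Type u} [Fintype V] (G : SimpleGraph V) (K : Finset V) : Finset V :=
  Finset.univ.filter fun u => Odd (K.filter fun w => G.Adj u w).card

/-- A g-flow `(g, ≺)` on an open graph; `≺` is a strict partial order. -/
structure GFlow {V : Type u} [Fintype V] (Γ : OpenGraph V) where
  g : Γ.Measured → Finset V
  prec : V → V → Prop
  irrefl : ∀ i, ¬ prec i i
  trans : ∀ i j k, prec i j → prec j k → prec i k
  g_nonempty : ∀ i, (g i).Nonempty
  g_not_input : ∀ i, ∀ j ∈ g i, j ∉ Γ.input
  prec_of_mem : ∀ i, ∀ j ∈ g i, prec i j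
  prec_of_mem_odd : ∀ i, ∀ j ∈ oddNbhd Γ.graph (g i), j ≠ i → prec i j
  mem_odd : ∀ i, (i : V) ∈ oddNbhd Γ.graph (g i)

/-- The public part of a measurement pattern: an open graph, a g-flow, and an order in which
the non-output nodes are measured, compatible with the g-flow. -/
structure Pattern (V : Type u) [Fintype V] [DecidableEq V] extends OpenGraph V where
  flow : GFlow toOpenGraph
  order : Fin (Fintype.card toOpenGraph.Measured) ≃ toOpenGraph.Measured
  order_lt : ∀ s t, flow.prec (order s) (order t) → s < t

/-- The secret part of a measurement pattern: the angle `φ_v ∈ {kπ/4 : k = 0, …, 7}` of every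
measured node, given by `k`. -/
abbrev Angles {V : Type u} [Fintype V] [DecidableEq V] (P : Pattern V) := P.Measured → Fin 8

section Pattern

variable {V : Type u} [Fintype V] [DecidableEq V] (P : Pattern V)

open scoped Classical in
/-- `s_X` at the node `w` is odd: parity of the outcomes `s_j` over `w ∈ g(j)`. -/
def Pattern.sX (s : P.Measured → Bool) (w : V) : Prop :=
  Odd (Finset.univ.filter fun j : P.Measured => w ∈ P.flow.g j ∧ s j = true).card

open scoped Classical in
/-- `s_Z` at the node `w` is odd: parity of the outcomes `s_j` over `w ∈ Odd(g(j))`, `j ≠ w`. -/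
def Pattern.sZ (s : P.Measured → Bool) (w : V) : Prop :=
  Odd (Finset.univ.filter fun j : P.Measured =>
    w ∈ oddNbhd P.graph (P.flow.g j) ∧ (j : V) ≠ w ∧ s j = true).card

open scoped Classical in
/-- The corrected angle `φ'_w = (-1)^{s_X} φ_w + s_Z π`. -/
noncomputable def Pattern.corrected (φ : Angles P) (s : P.Measured → Bool) (w : P.Measured) :
    Real.Angle :=
  (if P.sX s w then -1 else 1 : ℤ) • (((φ w : ℕ) * (Real.pi / 4) : ℝ) : Real.Angle)
    + (if P.sZ s w then (Real.pi : Real.Angle) else 0)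

open scoped Classical in
/-- The unitary `∏_{(i,j) ∈ E} CZ_{(i,j)}`, which is diagonal in the computational basis. -/
noncomputable def Pattern.entangle : Op (Reg V) :=
  Matrix.diagonal fun x => ∏ e ∈ P.graph.edgeFinset, if ∀ v ∈ e, x v = 1 then -1 else 1

/-- The initial state when the measured nodes carry `ρ` and every output node carries `|+⟩`. -/
noncomputable def Pattern.initial (ρ : Op (Reg P.Measured)) : Op (Reg V) :=
  Matrix.of fun x y => ρ (fun v => x v) (fun v => y v) *
    proj (prodKet fun _ : P.Out => ketPlus 0) (fun o => x o) (fun o => y o)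

/-- The operator `⟨±_{δ}| ⊗ 1` that projects every measured node `v` on `|+_{δ_v}⟩`
(outcome `b_v = 0`) or `|-_{δ_v}⟩` (outcome `b_v = 1`) and leaves the output nodes. -/
noncomputable def Pattern.measure (δ : P.Measured → Real.Angle) (b : P.Measured → Bool) :
    Matrix (Reg P.Out) (Reg V) ℂ :=
  Matrix.of fun y x => (if (fun o : P.Out => x o) = y then 1 else 0) *
    star (prodKet (fun v : P.Measured => ketXY (δ v) (b v)) fun v => x v)

open scoped Classical in
/-- The client's correction `⨂_o X^{s_X} Z^{s_Z}` of the output qubits. -/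
noncomputable def Pattern.outputCorrection (s : P.Measured → Bool) : Op (Reg P.Out) :=
  Matrix.of fun y x => ∏ o : P.Out,
    ((if P.sX s o then !![0, 1; 1, 0] else 1) * (if P.sZ s o then !![1, 0; 0, -1] else 1) :
      Matrix (Fin 2) (Fin 2) ℂ) (y o) (x o)

/-- The angle `δ_v = φ'_v + α_v + r_v π` announced by a client that has secret angles `α` and secret
bits `r` and has received the outcomes `b`. The client decodes the outcomes as `s = b ⊕ r`.
Only outcomes of nodes measured before `v` enter. -/
noncomputable def Pattern.announced (φ : Angles P) (α : P.Measured → Real.Angle)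
    (r b : P.Measured → Bool) (v : P.Measured) : Real.Angle :=
  P.corrected φ (fun j => xor (b j) (r j)) v + α v + (if r v then (Real.pi : Real.Angle) else 0)

/-- The state of the output qubits, as corrected by the client, after an honest execution in which
the measured nodes carry `ρ` and the client uses the secret angles `α` and bits `r`:
entangle, measure node after node at the announced angles, correct;
the sum is over the outcomes `b` reported by the server. -/
noncomputable def Pattern.execute (φ : Angles P) (ρ : Op (Reg P.Measured))
    (α : P.Measured → Real.Angle) (r : P.Measured → Bool) : Op (Reg P.Out) :=
  ∑ b : P.Measured → Bool,
    let K : Matrix (Reg P.Out) (Reg V) ℂ :=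
      P.outputCorrection (fun j => xor (b j) (r j)) * P.measure (P.announced φ α r b) b * P.entangle
    K * P.initial ρ * K.conjTranspose

/-- The correct result of the computation with angles `φ`: the output of the plain pattern,
run on the graph state `|G⟩` (all nodes in `|+⟩`) and without any hiding. -/
noncomputable def Pattern.target (φ : Angles P) : Op (Reg P.Out) :=
  P.execute φ (proj (prodKet fun _ => ketPlus 0)) (fun _ => 0) (fun _ => false)

end Pattern

/-! ## Protocols with a server-side operation -/

/-- The client of a UBQC protocol on the pattern `P` in which the nodes of `S` are to be served,
by the server, out of `k` resource states. A private random value `ω` fixes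
* the angles `θ` of the `k` resource states `|+_θ⟩` that are sent to the server,
* the state `τ` of the remaining measured nodes, which is sent to the server as well,
* the secret angle `α` of every measured node, by which the measurement angle is hidden. -/
structure Client {V : Type u} [Fintype V] [DecidableEq V] (P : Pattern V)
    (S : Finset P.Measured) (k : ℕ) where
  Ω : Type
  [fintypeΩ : Fintype Ω]
  p : Ω → ℝ
  p_nonneg : ∀ ω, 0 ≤ p ω
  p_sum : ∑ ω, p ω = 1
  θ : Ω → Fin k → Real.Angle
  τ : Ω → Op (Reg {v : P.Measured // v ∉ S})
  τ_state : ∀ ω, IsState (τ ω)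
  α : Ω → P.Measured → Real.Angle

attribute [instance] Client.fintypeΩ

/-- A (possibly malicious) server with memory `W`, to which the system `R` is sent. It acts on what
it received, and in every round it applies to its memory a quantum instrument, depending on
the past angles and answers and on the newly announced angle, whose outcome is its answer. -/
structure Server (R W : Type u) [Fintype R] [Fintype W] where
  load : Op R →ₗ[ℂ] Op W
  load_channel : IsChannel load
  step : List (Real.Angle × Bool) → Real.Angle → Bool → (Op W →ₗ[ℂ] Op W)
  step_cp : ∀ h δ b, IsCompletelyPositive (step h δ b)
  step_tp : ∀ h δ X, (∑ b, step h δ b X).trace = X.trace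

/-- The unnormalized memory after the rounds `l` that follow the rounds `h`. -/
def Server.rounds {R W : Type u} [Fintype R] [Fintype W] (A : Server R W) :
    List (Real.Angle × Bool) → List (Real.Angle × Bool) → Op W → Op W
  | _, [], X => X
  | h, (δ, b) :: l, X => A.rounds (h ++ [(δ, b)]) l (A.step h δ b X)

namespace Client

variable {V : Type u} [Fintype V] [DecidableEq V] {P : Pattern V} {S : Finset P.Measured} {k : ℕ}

/-- The system sent by the client: `k` resource qubits and one qubit for every measured node
outside `S`. -/
abbrev Sent (_ : Client P S k) : Type u := Reg (Fin k) × Reg {v : P.Measured // v ∉ S}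

/-- The number of qubits sent by the client. -/
def qubitsSent (_ : Client P S k) : ℕ := k + Fintype.card {v : P.Measured // v ∉ S}

/-- The joint resource state `|+_{θ_1}⟩ ⊗ ⋯ ⊗ |+_{θ_k}⟩`, as a density operator. -/
noncomputable def resource (C : Client P S k) (ω : C.Ω) : Op (Reg (Fin k)) :=
  proj (prodKet fun i => ketPlus (C.θ ω i))

/-- The state sent by the client. -/
noncomputable def sentState (C : Client P S k) (ω : C.Ω) : Op C.Sent :=
  Matrix.kroneckerMap (· * ·) (C.resource ω) (C.τ ω)

/-- The state of the measured nodes after the server has applied `Λ` to the resource states: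
`Λ(|+_θ⟩⟨+_θ|)` on the nodes of `S` and `τ` on the others. -/
noncomputable def nodeState (C : Client P S k)
    (Λ : Op (Reg (Fin k)) →ₗ[ℂ] Op (Reg {v : P.Measured // v ∈ S})) (ω : C.Ω) :
    Op (Reg P.Measured) :=
  Matrix.of fun x y =>
    Λ (C.resource ω) (fun v => x v) (fun v => y v) * C.τ ω (fun v => x v) (fun v => y v)

/-- Completeness: with an honest server, which applies `Λ`, the client obtains the correct result,
for every computation on the pattern. The bits `r` are uniform and independent of `ω`. -/
def Complete (C : Client P S k)
    (Λ : Op (Reg (Fin k)) →ₗ[ℂ] Op (Reg {v : P.Measured // v ∈ S})) : Prop :=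
  ∀ φ : Angles P,
    ∑ ω, ∑ r : P.Measured → Bool, ((C.p ω / 2 ^ Fintype.card P.Measured : ℝ) : ℂ) •
      P.execute φ (C.nodeState Λ ω) (C.α ω) r = P.target φ

open scoped Classical in
/-- The view of the server `A` when the client runs the computation `φ`: for every transcript
of announced angles `δ` and answers `b`, the memory of the server, weighted by the probability of
that transcript. -/
noncomputable def view (C : Client P S k) {W : Type u} [Fintype W] (A : Server C.Sent W)
    (φ : Angles P) (δ : P.Measured → Real.Angle) (b : P.Measured → Bool) : Op W :=
  ∑ ω, ∑ r : P.Measured → Bool,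
    if P.announced φ (C.α ω) r b = δ then
      ((C.p ω / 2 ^ Fintype.card P.Measured : ℝ) : ℂ) •
        A.rounds [] (List.ofFn fun t => (δ (P.order t), b (P.order t))) (A.load (C.sentState ω))
    else 0

/-- Blindness: whatever the server does, its view does not depend on the computation. -/
def Blind (C : Client P S k) : Prop :=
  ∀ (W : Type u) [Fintype W] (A : Server C.Sent W) (φ φ' : Angles P),
    C.view A φ = C.view A φ'

end Client

end UBQC

/-!
Part (i) is the case `k = 1` of part (ii), and part (ii) says that `|S| ≤ k`.

Determinism and rigidity. The sign `(-1)^{e(z)}` of the graph state at the label `z` is quadratic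
in `z`. Hence, for a pattern with a g-flow, all branches produce the same pure state up to a scalar
(`Pattern.exists_branch_plus`), and the norm of the branch with outcomes `0` is the same for all
measurement angles (`Pattern.sum_amp_mul_star`). Since the correct result is pure, completeness
forces every branch, applied to any column of any state `ρ` of the measured nodes that occurs, into
the line of the correct result. For the branch with outcomes `0` this relates two vectors of
multi-affine polynomials in `w_v = e^{-iφ_v}`: the vector `F` in which the entries of the column,
up to the phases `e^{-iα_v}`, multiply the coefficients is proportional to the vector `T` of the
graph state whenever the `w_v` are eighth roots of unity. As `T` has constant norm on the torus,
the factor between them is a Laurent polynomial, and a comparison of degrees shows that it is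
constant (`eq_of_proportional`). Therefore `ρ` is the product of the `|+_{α_v}⟩`, and the channel
turns the resource states into
`⨂_{v ∈ S} |+_{α_v}⟩` (`Client.Complete.channel_resource`).

Blindness. A server that stores what it receives and always answers `0` learns `δ = ±φ + α` up to
multiples of `π`. If some `n_v` is odd, the character `e^{2i n·φ}` takes the values `1` and `-1` for
two computations with angles in `{0, π/2}`, whatever the signs. The means of the sent states,
weighted by `e^{2i n·δ}`, are therefore opposite to each other, and by blindness they are equal, so
the sent states, weighted by `e^{2i n·α}`, add up to zero (`Client.Blind.sum_sentState_eq_zero`).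
Through the channel this says that the characters `e^{i q·α}`, `q ∈ {-1, 0, 1}^S`, are orthonormal
functions of the private random value (`Client.sum_triChar_mul_star`).

Counting. These `3 ^ |S|` functions are multiples of matrix elements of the output of the channel,
so by linearity they lie in the span of the functions `e^{i m·θ}`, `m ∈ {-1, 0, 1}^k`, that occur in
the matrix elements of the resource states. Hence `3 ^ |S| ≤ 3 ^ k`.
-/

namespace UBQC

/-! ### Signs of parities and of graph states -/

theorem add_eq_one_iff (a b : Fin 2) : a + b = 1 ↔ ¬(a = 1 ↔ b = 1) := by
  revert a b; decide

theorem eq_zero_or_one (a : Fin 2) : a = 0 ∨ a = 1 := by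
  revert a; decide

theorem ite_odd_neg_one (n : ℕ) [Decidable (Odd n)] :
    (if Odd n then (-1 : ℂ) else 1) = (-1) ^ n := by
  split_ifs with h
  · exact h.neg_one_pow.symm
  · exact (Nat.not_odd_iff_even.1 h).neg_one_pow.symm

/-- The parity of a filtered set, as a product of signs. -/
theorem ite_odd_card_filter {ι : Type*} (s : Finset ι) (p : ι → Prop) [DecidablePred p]
    [Decidable (Odd (s.filter p).card)] :
    (if Odd (s.filter p).card then (-1 : ℂ) else 1) = ∏ i ∈ s, if p i then -1 else 1 := by
  rw [ite_odd_neg_one, Finset.prod_ite]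
  simp

open scoped Classical in
/-- A product over ordered adjacent pairs, as a product over edges. -/
theorem prod_edgeFinset_mul_swap {V : Type*} [Fintype V] (G : SimpleGraph V)
    (f : V → V → ℂ) :
    ∏ e ∈ G.edgeFinset,
        Sym2.lift ⟨fun i j => f i j * f j i, fun _ _ => mul_comm _ _⟩ e =
      ∏ i, ∏ j, if G.Adj i j then f i j else 1 := by
  have h1 : ∏ d : G.Dart, f d.fst d.snd = ∏ i, ∏ j, if G.Adj i j then f i j else 1 := by
    rw [← Fintype.prod_prod_type' (f := fun i j => if G.Adj i j then f i j else 1),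
      ← Finset.prod_filter]
    refine Finset.prod_bij (fun d _ => d.toProd) ?_ ?_ ?_ ?_
    · intro d _
      simp [d.adj]
    · intro d _ d' _ h
      exact SimpleGraph.Dart.ext _ _ h
    · intro p hp
      exact ⟨⟨p, by simpa using hp⟩, Finset.mem_univ _, rfl⟩
    · intro d _
      rfl
  rw [← h1, ← Finset.prod_fiberwise_of_maps_to (s := Finset.univ) (t := G.edgeFinset)
    (g := fun d : G.Dart => d.edge) (fun d _ => by simp [d.edge_mem])]
  refine Finset.prod_congr rfl fun e he => ?_
  induction e using Sym2.ind with
  | _ i j =>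
    have hij : G.Adj i j := by simpa using he
    have hf : (Finset.univ.filter fun d : G.Dart => d.edge = s(i, j)) =
        {(⟨(i, j), hij⟩ : G.Dart), (⟨(i, j), hij⟩ : G.Dart).symm} := by
      convert SimpleGraph.Dart.edge_fiber (⟨(i, j), hij⟩ : G.Dart) using 2
      exact Iff.rfl
    rw [hf, Finset.prod_pair (SimpleGraph.Dart.symm_ne _).symm]
    simp

section

variable {V : Type*} [Fintype V] [DecidableEq V] (P : Pattern V)

open scoped Classical in
/-- The diagonal entries of the entangling unitary. -/
noncomputable def Pattern.edgeSign (z : Reg V) : ℂ :=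
  ∏ e ∈ P.graph.edgeFinset, if ∀ v ∈ e, z v = 1 then -1 else 1

theorem Pattern.entangle_eq : P.entangle = Matrix.diagonal P.edgeSign := rfl

open scoped Classical in
/-- The parity of the neighbours of `u` that carry the label `1` in `a`, as a sign. -/
noncomputable def Pattern.nbhdSign (a : Reg V) (u : V) : ℂ :=
  ∏ w, if P.graph.Adj u w then (if a w = 1 then -1 else 1) else 1

theorem Pattern.edgeSign_sq (z : Reg V) : P.edgeSign z * P.edgeSign z = 1 := by
  classical
  rw [edgeSign, ← Finset.prod_mul_distrib]
  refine Finset.prod_eq_one fun e _ => ?_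
  split_ifs <;> norm_num

theorem Pattern.nbhdSign_sq (a : Reg V) (u : V) : P.nbhdSign a u * P.nbhdSign a u = 1 := by
  classical
  rw [nbhdSign, ← Finset.prod_mul_distrib]
  refine Finset.prod_eq_one fun e _ => ?_
  split_ifs <;> norm_num

theorem Pattern.star_edgeSign (z : Reg V) : star (P.edgeSign z) = P.edgeSign z := by
  classical
  rw [edgeSign, star_prod]
  refine Finset.prod_congr rfl fun e _ => ?_
  split_ifs <;> simp

/-- The sign `(-1)^{e(z)}` of the graph state is quadratic: its polarization is the
adjacency form. -/
theorem Pattern.edgeSign_add (z a : Reg V) :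
    P.edgeSign (z + a) =
      P.edgeSign z * P.edgeSign a * ∏ u, if z u = 1 then P.nbhdSign a u else 1 := by
  classical
  have h : (∏ u, if z u = 1 then P.nbhdSign a u else 1) =
      ∏ u, ∏ w, if P.graph.Adj u w then (if z u = 1 ∧ a w = 1 then (-1 : ℂ) else 1) else 1 := by
    refine Finset.prod_congr rfl fun u _ => ?_
    by_cases hu : z u = 1 <;> simp [hu, nbhdSign]
  rw [h, ← prod_edgeFinset_mul_swap P.graph fun u w => if z u = 1 ∧ a w = 1 then (-1 : ℂ) else 1]
  simp only [edgeSign]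
  rw [← Finset.prod_mul_distrib, ← Finset.prod_mul_distrib]
  refine Finset.prod_congr rfl fun e _ => ?_
  induction e using Sym2.ind with
  | _ i j =>
    simp only [Sym2.mem_iff, forall_eq_or_imp, forall_eq, Pi.add_apply, Sym2.lift_mk,
      add_eq_one_iff]
    by_cases h1 : z i = 1 <;> by_cases h2 : z j = 1 <;> by_cases h3 : a i = 1 <;>
      by_cases h4 : a j = 1 <;> simp [h1, h2, h3, h4]

theorem Pattern.nbhdSign_indicator (K : Finset V) (u : V) :
    P.nbhdSign (fun w => if w ∈ K then 1 else 0) u =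
      if u ∈ oddNbhd P.graph K then -1 else 1 := by
  classical
  simp only [oddNbhd, Finset.mem_filter, Finset.mem_univ, true_and]
  rw [ite_odd_card_filter, nbhdSign, ← Finset.prod_subset (Finset.subset_univ K)]
  · refine Finset.prod_congr rfl fun w hw => ?_
    simp [hw]
  · intro w _ hw
    simp [hw]

end

/-! ### Phases -/

/-- The phase `e^{iθ}`. -/
noncomputable def phase (θ : Real.Angle) : ℂ := (θ.toCircle : ℂ)

theorem phase_zero : phase 0 = 1 := by simp [phase]

theorem phase_add (θ η : Real.Angle) : phase (θ + η) = phase θ * phase η := by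
  simp [phase, Real.Angle.toCircle_add]

theorem star_phase (θ : Real.Angle) : star (phase θ) = phase (-θ) := by
  rw [phase, phase, Real.Angle.toCircle_neg, Circle.coe_inv_eq_conj]
  rfl

theorem phase_mul_star (θ : Real.Angle) : phase θ * star (phase θ) = 1 := by
  rw [star_phase, ← phase_add, add_neg_cancel, phase_zero]

theorem phase_ne_zero (θ : Real.Angle) : phase θ ≠ 0 :=
  left_ne_zero_of_mul_eq_one (phase_mul_star θ)

theorem phase_coe (x : ℝ) : phase (x : Real.Angle) = Complex.exp (x * Complex.I) := by
  simp [phase, Real.Angle.toCircle_coe, Circle.coe_exp]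

theorem phase_pi : phase (Real.pi : Real.Angle) = -1 := by
  rw [phase_coe, Complex.exp_pi_mul_I]

theorem ketXY_apply (θ : Real.Angle) (b : Bool) (a : Fin 2) :
    ketXY θ b a = ((Real.sqrt 2)⁻¹ : ℂ) *
      (if a = 1 then (if b then -1 else 1) * phase θ else 1) := by
  fin_cases a <;> simp [ketXY, phase]

section

variable {V : Type*} [Fintype V] [DecidableEq V] (P : Pattern V)

/-! ### Branches of the honest execution -/

theorem proj_conj {a b : Type*} [Fintype a] (A : Matrix b a ℂ) (ψ : a → ℂ) :
    A * proj ψ * A.conjTranspose = proj (A.mulVec ψ) := by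
  rw [proj, proj, Matrix.mul_vecMulVec, Matrix.vecMulVec_mul, Matrix.star_mulVec]

theorem prodKet_plus {ι : Type*} [Fintype ι] (x : Reg ι) :
    prodKet (fun _ => ketPlus 0) x = ((Real.sqrt 2)⁻¹ : ℂ) ^ Fintype.card ι := by
  simp [prodKet, ketPlus, ketXY_apply, phase_zero]

/-- The isometry that adds output nodes in the state `|+⟩`. -/
noncomputable def Pattern.addOutputs : Matrix (Reg V) (Reg P.Measured) ℂ :=
  Matrix.of fun z x => (if (fun v : P.Measured => z v) = x then 1 else 0) *
    prodKet (fun _ : P.Out => ketPlus 0) fun o => z o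

theorem Pattern.addOutputs_mulVec (ψ : Reg P.Measured → ℂ) (z : Reg V) :
    P.addOutputs.mulVec ψ z =
      ψ (fun v => z v) * prodKet (fun _ : P.Out => ketPlus 0) fun o => z o := by
  simp [Matrix.mulVec, dotProduct, addOutputs, mul_comm]

theorem Pattern.initial_eq (ρ : Op (Reg P.Measured)) :
    P.initial ρ = P.addOutputs * ρ * P.addOutputs.conjTranspose := by
  ext z z'
  simp only [initial, addOutputs, Matrix.mul_apply, proj, Matrix.vecMulVec_apply, Matrix.of_apply,
    Matrix.conjTranspose_apply, Pi.star_apply]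
  rw [Finset.sum_eq_single (fun v : P.Measured => z' v) (fun x _ h => by simp [h.symm]) (by simp)]
  simp
  ring

/-- The Kraus operator, from the measured to the output nodes, of the branch in which the
server reports `b`. -/
noncomputable def Pattern.branch (φ : Angles P) (α : P.Measured → Real.Angle)
    (r b : P.Measured → Bool) : Matrix (Reg P.Out) (Reg P.Measured) ℂ :=
  P.outputCorrection (fun j => xor (b j) (r j)) * P.measure (P.announced φ α r b) b * P.entangle *
    P.addOutputs

theorem Pattern.execute_eq (φ : Angles P) (ρ : Op (Reg P.Measured))
    (α : P.Measured → Real.Angle) (r : P.Measured → Bool) :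
    P.execute φ ρ α r = ∑ b, P.branch φ α r b * ρ * (P.branch φ α r b).conjTranspose := by
  refine Finset.sum_congr rfl fun b _ => ?_
  simp only [P.initial_eq, branch, Matrix.conjTranspose_mul, Matrix.mul_assoc]

theorem Pattern.branch_mulVec (φ : Angles P) (α : P.Measured → Real.Angle)
    (r b : P.Measured → Bool) (ψ : Reg P.Measured → ℂ) (y : Reg P.Out) :
    (P.branch φ α r b).mulVec ψ y =
      ((Real.sqrt 2)⁻¹ : ℂ) ^ Fintype.card P.Out *
      ∑ z : Reg V, P.outputCorrection (fun j => xor (b j) (r j)) y (fun o => z o) *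
        star (prodKet (fun v : P.Measured => ketXY (P.announced φ α r b v) (b v)) fun v => z v) *
        P.edgeSign z * ψ fun v => z v := by
  rw [branch, ← Matrix.mulVec_mulVec, P.entangle_eq, Matrix.mulVec, dotProduct, Finset.mul_sum]
  refine Finset.sum_congr rfl fun z _ => ?_
  rw [Matrix.mul_diagonal, P.addOutputs_mulVec, prodKet_plus]
  simp [Matrix.mul_apply, measure]
  ring

/-- The label of all the nodes made of one of the measured and one of the output nodes. -/
def Pattern.glue (x : Reg P.Measured) (y : Reg P.Out) : Reg V :=
  fun v => if h : v ∈ P.output then y ⟨v, h⟩ else x ⟨v, h⟩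

theorem Pattern.glue_measured (x : Reg P.Measured) (y : Reg P.Out) (v : P.Measured) :
    P.glue x y v = x v := by
  simp [glue, v.2]

theorem Pattern.glue_out (x : Reg P.Measured) (y : Reg P.Out) (o : P.Out) :
    P.glue x y o = y o := by
  simp [glue, o.2]

/-- Splitting of a label into its measured and its output part. -/
def Pattern.glueEquiv : Reg P.Measured × Reg P.Out ≃ Reg V where
  toFun p := P.glue p.1 p.2
  invFun z := (fun v => z v, fun o => z o)
  left_inv p := by
    ext v
    · simp [P.glue_measured]
    · simp [P.glue_out]
  right_inv z := by
    ext v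
    simp only [glue]
    split_ifs <;> rfl

theorem Pattern.sum_glue {A : Type*} [AddCommMonoid A] (f : Reg V → A) :
    ∑ z, f z = ∑ x, ∑ y, f (P.glue x y) := by
  rw [← Fintype.sum_prod_type', ← P.glueEquiv.sum_comp]
  rfl

theorem Pattern.prod_glue (f : V → ℂ) : ∏ v, f v = (∏ v : P.Measured, f v) * ∏ o : P.Out, f o := by
  rw [mul_comm]
  convert (Fintype.prod_subtype_mul_prod_subtype (fun v => v ∈ P.output) f).symm

/-- The monomial `w^x`. -/
def mono {ι : Type*} [Fintype ι] (w : ι → ℂ) (x : Reg ι) : ℂ := ∏ v, if x v = 1 then w v else 1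

/-- The amplitudes, up to normalization, of the output qubits when the nodes of the graph state
carry the additional amplitudes `ψ`, and every measured node `v` is projected
on `|0⟩ + conj (w v) |1⟩`. -/
noncomputable def Pattern.amp (w : P.Measured → ℂ) (ψ : Reg P.Measured → ℂ) (y : Reg P.Out) : ℂ :=
  ∑ x, mono w x * P.edgeSign (P.glue x y) * ψ x

/-- The angle of a measured node. -/
noncomputable def Pattern.angle (φ : Angles P) (v : P.Measured) : Real.Angle :=
  (((φ v : ℕ) * (Real.pi / 4) : ℝ) : Real.Angle)

open scoped Classical in
theorem Pattern.corrected_eq (φ : Angles P) (s : P.Measured → Bool) (v : P.Measured) :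
    P.corrected φ s v = (if P.sX s v then -P.angle φ v else P.angle φ v) +
      if P.sZ s v then (Real.pi : Real.Angle) else 0 := by
  simp only [corrected, angle]
  split_ifs <;> simp

theorem Pattern.not_sX (v : V) : ¬ P.sX (fun _ => false) v := by simp [sX]

theorem Pattern.not_sZ (v : V) : ¬ P.sZ (fun _ => false) v := by simp [sZ]

theorem Pattern.corrected_false (φ : Angles P) (v : P.Measured) :
    P.corrected φ (fun _ => false) v = P.angle φ v := by
  rw [P.corrected_eq, if_neg (P.not_sX _), if_neg (P.not_sZ _), add_zero]

theorem Pattern.outputCorrection_false : P.outputCorrection (fun _ => false) = 1 := by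
  ext y x
  simp only [outputCorrection, if_neg (P.not_sX _), if_neg (P.not_sZ _), Matrix.of_apply, mul_one,
    Matrix.one_apply]
  rw [Finset.prod_ite_zero]
  simp [funext_iff]

theorem star_prodKet_ketXY {ι : Type*} [Fintype ι] (δ : ι → Real.Angle) (b : ι → Bool)
    (x : Reg ι) :
    star (prodKet (fun v => ketXY (δ v) (b v)) x) = ((Real.sqrt 2)⁻¹ : ℂ) ^ Fintype.card ι *
      mono (fun v => (if b v then -1 else 1) * star (phase (δ v))) x := by
  simp only [prodKet, ketXY_apply, mono, Finset.prod_mul_distrib, star_mul', star_prod]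
  congr 1
  · simp
  · refine Finset.prod_congr rfl fun v _ => ?_
    split_ifs <;> simp

theorem mono_mul {ι : Type*} [Fintype ι] (w w' : ι → ℂ) (x : Reg ι) :
    mono (fun v => w v * w' v) x = mono w x * mono w' x := by
  rw [mono, mono, mono, ← Finset.prod_mul_distrib]
  refine Finset.prod_congr rfl fun v _ => ?_
  split_ifs <;> simp

/-- The branch in which all reported and decoded outcomes are `0`. -/
theorem Pattern.branch_false_mulVec (φ : Angles P) (α : P.Measured → Real.Angle)
    (ψ : Reg P.Measured → ℂ) (y : Reg P.Out) :
    (P.branch φ α (fun _ => false) (fun _ => false)).mulVec ψ y =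
      ((Real.sqrt 2)⁻¹ : ℂ) ^ Fintype.card P.Out *
      ((Real.sqrt 2)⁻¹ : ℂ) ^ Fintype.card P.Measured *
      P.amp (fun v => star (phase (P.angle φ v)))
        (fun x => mono (fun v => star (phase (α v))) x * ψ x) y := by
  rw [P.branch_mulVec, amp, P.sum_glue, mul_assoc]
  congr 1
  rw [Finset.mul_sum]
  refine Finset.sum_congr rfl fun x _ => ?_
  simp only [Bool.xor_false, P.outputCorrection_false, P.glue_out, P.glue_measured,
    Matrix.one_apply, star_prodKet_ketXY, announced, P.corrected_false, phase_add, star_mul']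
  rw [Finset.sum_eq_single y (fun y' _ h => by simp [h.symm]) (by simp)]
  simp [phase_zero, mono_mul]
  ring

/-! ### Determinism of patterns with a g-flow -/

open scoped Classical in
/-- The set of nodes on which the outcomes `s` require an `X` correction, as a label. -/
noncomputable def Pattern.xShift (s : P.Measured → Bool) : Reg V :=
  fun w => if P.sX s w then 1 else 0

theorem Pattern.nbhdSign_xShift (s : P.Measured → Bool) (u : V)
    [DecidablePred fun j : P.Measured => s j = true ∧ u ∈ oddNbhd P.graph (P.flow.g j)] :
    P.nbhdSign (P.xShift s) u =
      ∏ j : P.Measured, if s j = true ∧ u ∈ oddNbhd P.graph (P.flow.g j) then -1 else 1 := by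
  classical
  have h1 : ∀ w, (if P.xShift s w = 1 then (-1 : ℂ) else 1) =
      ∏ j : P.Measured, if w ∈ P.flow.g j ∧ s j = true then -1 else 1 := by
    intro w
    rw [← ite_odd_card_filter]
    by_cases h : P.sX s w
    · have h' := h
      rw [sX] at h'
      rw [if_pos (by simp [xShift, h]), if_pos (by convert h')]
    · have h' := h
      rw [sX] at h'
      rw [if_neg (by simp [xShift, h]), if_neg (by convert h')]
  have h2 : P.nbhdSign (P.xShift s) u = ∏ w, ∏ j : P.Measured,
      if P.graph.Adj u w then (if w ∈ P.flow.g j ∧ s j = true then (-1 : ℂ) else 1) else 1 := by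
    rw [nbhdSign]
    refine Finset.prod_congr rfl fun w _ => ?_
    rw [h1]
    split_ifs <;> simp
  rw [h2, Finset.prod_comm]
  refine Finset.prod_congr rfl fun j _ => ?_
  by_cases hj : s j = true
  · have := P.nbhdSign_indicator (P.flow.g j) u
    rw [nbhdSign] at this
    simp only [hj, and_true, true_and]
    rw [← this]
    refine Finset.prod_congr rfl fun w _ => ?_
    by_cases hw : w ∈ P.flow.g j <;> simp [hw]
  · simp [hj]

open scoped Classical in
theorem Pattern.nbhdSign_xShift_out (s : P.Measured → Bool) (o : P.Out) :
    P.nbhdSign (P.xShift s) o = if P.sZ s o then -1 else 1 := by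
  rw [P.nbhdSign_xShift, sZ, ite_odd_card_filter]
  refine Finset.prod_congr rfl fun j _ => ?_
  have : (j : V) ≠ o := fun h => j.2 (h ▸ o.2)
  simp [this, and_comm]

open scoped Classical in
/-- At a measured node, the parity of the neighbours that are shifted consists of the `Z` correction
and, because `v ∈ Odd(g(v))`, of the outcome of the node itself. -/
theorem Pattern.nbhdSign_xShift_measured (s : P.Measured → Bool) (v : P.Measured) :
    P.nbhdSign (P.xShift s) v = (if s v then -1 else 1) * if P.sZ s v then -1 else 1 := by
  have h : (if s v then (-1 : ℂ) else 1) =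
      ∏ j : P.Measured, if j = v ∧ s j = true then -1 else 1 := by
    rw [Finset.prod_eq_single v (fun j _ h => by simp [h]) (by simp)]
    simp
  rw [P.nbhdSign_xShift, sZ, ite_odd_card_filter, h, ← Finset.prod_mul_distrib]
  refine Finset.prod_congr rfl fun j _ => ?_
  by_cases hj : j = v
  · subst hj
    simp [P.flow.mem_odd j]
  · have : (j : V) ≠ v := fun h => hj (Subtype.ext h)
    simp [hj, this, and_comm]

/-- The matrix elements of `X^p Z^q`, with the column shifted so that `X^p` becomes the identity. -/
theorem correction_apply (p q : Prop) [Decidable p] [Decidable q] (a b : Fin 2) :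
    ((if p then !![0, 1; 1, 0] else 1) * (if q then !![1, 0; 0, -1] else 1) :
      Matrix (Fin 2) (Fin 2) ℂ) a (b + if p then 1 else 0) =
    if a = b then (if (b + if p then 1 else 0) = 1 then (if q then -1 else 1) else 1) else 0 := by
  by_cases p <;> by_cases q <;> fin_cases a <;> fin_cases b <;> simp [*]

open scoped Classical in
theorem Pattern.outputCorrection_xShift (s : P.Measured → Bool) (y : Reg P.Out) (z : Reg V) :
    P.outputCorrection s y (fun o => (z + P.xShift s) o) =
      if (∀ o : P.Out, y o = z o) then
        ∏ o : P.Out, (if (z + P.xShift s) o = 1 then P.nbhdSign (P.xShift s) o else 1) else 0 := by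
  simp only [outputCorrection, Matrix.of_apply, Pi.add_apply, P.nbhdSign_xShift_out]
  simp only [xShift, correction_apply]
  rw [Finset.prod_ite_zero]
  simp only [Finset.mem_univ, forall_true_left]
  split_ifs <;> rfl

/-- The amplitudes of the corrected measurement vectors at a shifted label: the shift undoes the
change of sign of the angle, up to a global phase. -/
theorem Pattern.mono_xShift (φ : Angles P) (s : P.Measured → Bool) (z : Reg V) :
    mono (fun v => (if s v then -1 else 1) * star (phase (P.corrected φ s v)))
        (fun v => (z + P.xShift s) v) =
      mono (fun v => phase (P.angle φ v)) (fun v => P.xShift s v) *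
      mono (fun v => star (phase (P.angle φ v))) (fun v => z v) *
      ∏ v : P.Measured, (if (z + P.xShift s) v = 1 then P.nbhdSign (P.xShift s) v else 1) := by
  classical
  simp only [mono]
  rw [← Finset.prod_mul_distrib, ← Finset.prod_mul_distrib]
  refine Finset.prod_congr rfl fun v _ => ?_
  rw [P.nbhdSign_xShift_measured, P.corrected_eq, phase_add, Pi.add_apply]
  have h : phase (P.angle φ v) * starRingEnd ℂ (phase (P.angle φ v)) = 1 := phase_mul_star _
  have hz := eq_zero_or_one (z v)
  by_cases hX : P.sX s v <;> by_cases hZ : P.sZ s v <;> cases s v <;>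
    rcases hz with hz | hz <;>
    simp [xShift, hX, hZ, hz, phase_pi, phase_zero, ← star_phase, -RCLike.star_def, h]

/-- Determinism of a pattern with a g-flow: up to a scalar, all branches of the pattern give the
same output as the branch in which all outcomes are `0`. Shifting the summation label by the
`X` corrections turns one amplitude into the other, since the sign this produces in the graph state
is cancelled by the `Z` corrections and by the signs of the outcomes. -/
theorem Pattern.exists_branch_plus (φ : Angles P) (b : P.Measured → Bool) :
    ∃ κ : ℂ, ∀ y, (P.branch φ (fun _ => 0) (fun _ => false) b).mulVec
      (prodKet fun _ => ketPlus 0) y = κ * P.amp (fun v => star (phase (P.angle φ v))) 1 y := by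
  classical
  set X := P.xShift b with hX
  set D := ∏ u, if X u = 1 then P.nbhdSign X u else 1 with hD
  refine ⟨((Real.sqrt 2)⁻¹ : ℂ) ^ Fintype.card P.Out *
    (((Real.sqrt 2)⁻¹ : ℂ) ^ Fintype.card P.Measured *
      ((Real.sqrt 2)⁻¹ : ℂ) ^ Fintype.card P.Measured *
      mono (fun v => phase (P.angle φ v)) (fun v : P.Measured => X v) * P.edgeSign X * D),
    fun y => ?_⟩
  have hprod : ∀ z : Reg V, (∏ u, if (z + X) u = 1 then P.nbhdSign X u else 1) *
      (∏ u, if z u = 1 then P.nbhdSign X u else 1) = D := by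
    intro z
    rw [hD, ← Finset.prod_mul_distrib]
    refine Finset.prod_congr rfl fun u _ => ?_
    have h := P.nbhdSign_sq X u
    rcases eq_zero_or_one (z u) with h1 | h1 <;> rcases eq_zero_or_one (X u) with h2 | h2 <;>
      simp [h1, h2, h]
  rw [P.branch_mulVec, mul_assoc]
  congr 1
  rw [← Equiv.sum_comp (Equiv.addRight X), P.sum_glue, amp, Finset.mul_sum]
  refine Finset.sum_congr rfl fun x _ => ?_
  rw [Finset.sum_eq_single y]
  · have h := hprod (P.glue x y)
    simp only [Bool.xor_false, Equiv.coe_addRight, announced, star_prodKet_ketXY, prodKet_plus]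
    rw [P.outputCorrection_xShift, if_pos (by simp [P.glue_out]), P.edgeSign_add]
    simp only [add_zero, Bool.false_eq_true, if_false]
    rw [P.mono_xShift, ← h, P.prod_glue (fun u => if (P.glue x y + X) u = 1 then _ else _)]
    simp only [P.glue_measured, Pi.one_apply]
    ring
  · intro y' _ hy
    simp only [Bool.xor_false, Equiv.coe_addRight]
    rw [P.outputCorrection_xShift, if_neg]
    · simp
    · simp only [P.glue_out]
      exact fun h => hy (funext fun o => (h o).symm)
  · simp

end

section

variable {V : Type*} [Fintype V] [DecidableEq V] (P : Pattern V)

/-! ### Uniformity of the outcome probabilities -/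

theorem fin_two_cancel (a : Fin 2) : a + a = 0 := by
  revert a; decide

/-- The node of `d` that is measured last has a g-flow set whose stabilizer anticommutes
with a Pauli operator that is `X` or `Y` exactly on the nodes of `d`. -/
theorem Pattern.exists_anticommuting (d : Reg P.Measured) (hd : d ≠ 0) :
    ∃ a : Reg V, (∀ u : P.Measured, d u = 1 → a u = 0) ∧
      (∏ u, if P.glue d 0 u = 1 then P.nbhdSign a u else 1) = -1 := by
  classical
  obtain ⟨u₀, hu₀⟩ : ∃ u, d u = 1 := by
    by_contra h
    push Not at h
    exact hd (funext fun u => (eq_zero_or_one (d u)).resolve_right (h u))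
  obtain ⟨v, hv, hmax⟩ := Finset.exists_max_image (Finset.univ.filter fun u => d u = 1)
    P.order.symm ⟨u₀, by simp [hu₀]⟩
  simp only [Finset.mem_filter, Finset.mem_univ, true_and] at hv hmax
  have hprec : ∀ u : P.Measured, d u = 1 → ¬ P.flow.prec v u := by
    intro u hu h
    have := P.order_lt (P.order.symm v) (P.order.symm u) (by simpa using h)
    exact absurd (hmax u hu) (not_le.2 this)
  refine ⟨fun w => if w ∈ P.flow.g v then 1 else 0, fun u hu => ?_, ?_⟩
  · exact if_neg fun h => hprec u hu (P.flow.prec_of_mem _ _ h)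
  · rw [P.prod_glue]
    simp only [P.glue_measured, P.glue_out, P.nbhdSign_indicator]
    rw [Finset.prod_eq_single v]
    · simp [hv, P.flow.mem_odd v]
    · intro u _ huv
      split_ifs with h1 h2
      · exact absurd (P.flow.prec_of_mem_odd _ _ h2 fun h => huv (Subtype.ext h)) (hprec u h1)
      · rfl
      · rfl
    · simp

theorem Pattern.prod_nbhdSign_add (a z d : Reg V) :
    (∏ u, if z u = 1 then P.nbhdSign a u else 1) *
      (∏ u, if (z + d) u = 1 then P.nbhdSign a u else 1) =
    ∏ u, if d u = 1 then P.nbhdSign a u else 1 := by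
  rw [← Finset.prod_mul_distrib]
  refine Finset.prod_congr rfl fun u _ => ?_
  have h := P.nbhdSign_sq a u
  rcases eq_zero_or_one (z u) with h1 | h1 <;> rcases eq_zero_or_one (d u) with h2 | h2 <;>
    simp [h1, h2, h]

theorem mono_mul_star {ι : Type*} [Fintype ι] (w : ι → ℂ) (hw : ∀ v, w v * star (w v) = 1)
    (x : Reg ι) : mono w x * star (mono w x) = 1 := by
  rw [mono, star_prod, ← Finset.prod_mul_distrib]
  refine Finset.prod_eq_one fun v _ => ?_
  split_ifs
  · exact hw v
  · simp

theorem mono_mul_star_shift {ι : Type*} [Fintype ι] (w : ι → ℂ) (hw : ∀ v, w v * star (w v) = 1)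
    (x d a : Reg ι) (h : ∀ u, d u = 1 → a u = 0) :
    mono w (x + a) * star (mono w (x + d + a)) = mono w x * star (mono w (x + d)) := by
  simp only [mono, star_prod, ← Finset.prod_mul_distrib]
  refine Finset.prod_congr rfl fun v _ => ?_
  rcases eq_zero_or_one (d v) with hd | hd
  · simp only [Pi.add_apply, hd, add_zero]
    have := hw v
    split_ifs <;> simp_all
  · simp [hd, h v hd]

/-- The total weight of the branch in which all outcomes are `0` does not depend on the
measurement angles. -/
theorem Pattern.sum_amp_mul_star (w : P.Measured → ℂ) (hw : ∀ v, w v * star (w v) = 1) :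
    ∑ y, P.amp w 1 y * star (P.amp w 1 y) = 2 ^ Fintype.card V := by
  classical
  -- Expand the norm over pairs of labels `z`, `z + d` with equal output part. For `d ≠ 0` the sum
  -- changes sign under the translation of both labels by a g-flow set.
  set A : Reg V → ℂ := fun z => mono w (fun v => z v) * P.edgeSign z with hA
  have hamp : ∀ y, P.amp w 1 y = ∑ x, A (P.glue x y) := fun y => by
    simp [amp, hA, P.glue_measured]
  have hglue : ∀ x d y, P.glue (x + d) y = P.glue x y + P.glue d 0 := by
    intro x d y
    ext v
    simp only [glue, Pi.add_apply]
    split_ifs <;> simp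
  have hzero : ∀ d ≠ 0, ∑ z, A z * star (A (z + P.glue d 0)) = 0 := by
    intro d hd
    obtain ⟨a, ha, hs⟩ := P.exists_anticommuting d hd
    have key : ∀ z, A (z + a) * star (A (z + a + P.glue d 0)) =
        -(A z * star (A (z + P.glue d 0))) := by
      intro z
      have h1 := mono_mul_star_shift w hw (fun v => z v) d (fun v => a v) ha
      have h2 := P.prod_nbhdSign_add a z (P.glue d 0)
      rw [hs] at h2
      have h3 := P.edgeSign_sq a
      have e1 : (fun v : P.Measured => (z + a + P.glue d 0) v) =
          (fun v : P.Measured => z v) + d + fun v : P.Measured => a v := by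
        ext v
        simp [P.glue_measured, add_right_comm]
      have e2 : (fun v : P.Measured => (z + P.glue d 0) v) = (fun v : P.Measured => z v) + d := by
        ext v
        simp [P.glue_measured]
      have e3 : (fun v : P.Measured => (z + a) v) =
          (fun v : P.Measured => z v) + fun v : P.Measured => a v := rfl
      simp only [hA, e1, e2, e3, star_mul', P.star_edgeSign]
      rw [add_right_comm z a, P.edgeSign_add z a, P.edgeSign_add (z + _) a]
      linear_combination (P.edgeSign z * P.edgeSign (z + P.glue d 0)) *
        ((∏ u, if z u = 1 then P.nbhdSign a u else 1) *
          (∏ u, if (z + P.glue d 0) u = 1 then P.nbhdSign a u else 1) *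
          (P.edgeSign a * P.edgeSign a) * h1 +
         mono w (fun v => z v) * star (mono w ((fun v : P.Measured => z v) + d)) *
          ((P.edgeSign a * P.edgeSign a) * h2 - h3))
    have h := Equiv.sum_comp (Equiv.addRight a) fun z => A z * star (A (z + P.glue d 0))
    simp only [Equiv.coe_addRight, key, Finset.sum_neg_distrib] at h
    linear_combination (-1 / 2 : ℂ) * h
  have hone : ∀ z, A z * star (A z) = 1 := by
    intro z
    have h1 := mono_mul_star w hw fun v => z v
    have h2 := P.edgeSign_sq z
    simp only [hA, star_mul', P.star_edgeSign]
    linear_combination (P.edgeSign z * P.edgeSign z) * h1 + h2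
  calc ∑ y, P.amp w 1 y * star (P.amp w 1 y)
      = ∑ y, ∑ x, ∑ d, A (P.glue x y) * star (A (P.glue x y + P.glue d 0)) := by
        refine Finset.sum_congr rfl fun y _ => ?_
        rw [hamp, star_sum, Finset.sum_mul_sum]
        refine Finset.sum_congr rfl fun x _ => ?_
        rw [← Equiv.sum_comp (Equiv.addLeft x)]
        simp [hglue]
    _ = ∑ d, ∑ z, A z * star (A (z + P.glue d 0)) := by
        simp_rw [P.sum_glue]
        rw [Finset.sum_comm]
        conv_rhs => rw [Finset.sum_comm]
        exact Finset.sum_congr rfl fun x _ => Finset.sum_comm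
    _ = ∑ z, A z * star (A (z + P.glue 0 0)) :=
        Finset.sum_eq_single 0 (fun d _ hd => hzero d hd) (by simp)
    _ = 2 ^ Fintype.card V := by
        have : P.glue 0 0 = 0 := by
          ext v
          simp [glue]
        simp only [this, add_zero, hone]
        simp

end

/-! ### Rigidity of multi-affine families -/


/-- A label, as the exponent vector of a monomial. -/
noncomputable def expVec {ι : Type*} [Fintype ι] (x : Reg ι) : ι →₀ ℕ :=
  Finsupp.equivFunOnFinite.symm fun v => (x v : ℕ)

theorem expVec_apply {ι : Type*} [Fintype ι] (x : Reg ι) (v : ι) : expVec x v = (x v : ℕ) := rfl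

theorem expVec_injective {ι : Type*} [Fintype ι] : Function.Injective (expVec (ι := ι)) := by
  intro x y h
  ext v
  exact DFunLike.congr_fun h v

theorem eval_monomial_expVec {ι : Type*} [Fintype ι] (w : ι → ℂ) (x : Reg ι) (a : ℂ) :
    MvPolynomial.eval w (MvPolynomial.monomial (expVec x) a) = a * mono w x := by
  rw [MvPolynomial.eval_monomial, Finsupp.prod_fintype _ _ (by simp), mono]
  congr 1
  refine Finset.prod_congr rfl fun v _ => ?_
  rcases eq_zero_or_one (x v) with h | h <;> simp [expVec_apply, h]

/-- On the torus, conjugation turns a multi-affine polynomial into its reversal. -/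
theorem mono_reverse {ι : Type*} [Fintype ι] (w : ι → ℂ) (hw : ∀ v, w v * star (w v) = 1)
    (x : Reg ι) : mono w 1 * star (mono w x) = mono w (x + 1) := by
  simp only [mono, star_prod, ← Finset.prod_mul_distrib]
  refine Finset.prod_congr rfl fun v _ => ?_
  have h := hw v
  rcases eq_zero_or_one (x v) with hx | hx <;> simp_all

section

open MvPolynomial

/-- The multi-affine polynomial with coefficients `c`. -/
noncomputable def affPoly {ι : Type*} [Fintype ι] [DecidableEq ι] (c : Reg ι → ℂ) :
    MvPolynomial ι ℂ :=
  ∑ x, monomial (expVec x) (c x)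

variable {ι : Type*} [Fintype ι] [DecidableEq ι]

theorem eval_affPoly (c : Reg ι → ℂ) (w : ι → ℂ) :
    eval w (affPoly c) = ∑ x, c x * mono w x := by
  simp [affPoly, eval_monomial_expVec]

theorem coeff_affPoly (c : Reg ι → ℂ) (x : Reg ι) : coeff (expVec x) (affPoly c) = c x := by
  classical
  rw [affPoly, coeff_sum, Finset.sum_eq_single x]
  · simp
  · intro y _ h
    rw [coeff_monomial, if_neg fun h' => h (expVec_injective h')]
  · simp

theorem degreeOf_affPoly_le (c : Reg ι → ℂ) (v : ι) : degreeOf v (affPoly c) ≤ 1 := by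
  refine (degreeOf_sum_le _ _ _).trans (Finset.sup_le fun x _ => ?_)
  by_cases h : c x = 0
  · simp [h]
  · rw [degreeOf_monomial_eq _ _ h, expVec_apply]
    omega

theorem one_le_degreeOf_affPoly (c : Reg ι → ℂ) (v : ι) (h : c 1 ≠ 0) :
    1 ≤ degreeOf v (affPoly c) := by
  have : expVec (1 : Reg ι) ∈ (affPoly c).support := by
    rw [mem_support_iff, coeff_affPoly]
    exact h
  simpa [expVec_apply] using monomial_le_degreeOf v this

theorem not_X_dvd_affPoly (c : Reg ι → ℂ) (v : ι) (h : c 0 ≠ 0) : ¬ X v ∣ affPoly c := by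
  classical
  rintro ⟨q, hq⟩
  have := coeff_affPoly c 0
  rw [hq, coeff_X_mul', if_neg (by simp [expVec_apply])] at this
  exact h this.symm

/-- If a multi-affine polynomial times the product of all variables is a multiple of a multi-affine
polynomial whose extreme coefficients do not vanish, then the two are proportional. -/
theorem affPoly_proportional (c d : Reg ι → ℂ) (h0 : d 0 ≠ 0) (h1 : d 1 ≠ 0)
    (L : MvPolynomial ι ℂ) (h : monomial (expVec 1) 1 * affPoly c = L * affPoly d) :
    ∃ κ : ℂ, ∀ x, c x = κ * d x := by
  classical
  have hd : affPoly d ≠ 0 := fun h' => h0 (by rw [← coeff_affPoly d 0, h', coeff_zero])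
  have hsupp : ∀ m ∈ L.support, m = expVec 1 := by
    intro m hm
    have hL : L ≠ 0 := by
      rintro rfl
      simp at hm
    ext v
    -- The degree in each variable bounds the exponent by `1`, and divisibility by each variable
    -- bounds it below by `1`.
    apply le_antisymm
    · have h2 : degreeOf v (monomial (expVec 1) 1 * affPoly c) ≤ 1 + 1 := by
        refine (degreeOf_mul_le _ _ _).trans (add_le_add ?_ (degreeOf_affPoly_le c v))
        rw [degreeOf_monomial_eq _ _ one_ne_zero]
        simp [expVec_apply]
      rw [h, degreeOf_mul_eq hL hd] at h2
      have h3 := one_le_degreeOf_affPoly d v h1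
      have h4 := monomial_le_degreeOf v hm
      simp only [expVec_apply, Pi.one_apply]
      simp
      omega
    · have h2 : X v ∣ L * affPoly d := by
        rw [← h]
        refine Dvd.dvd.mul_right ?_ _
        rw [X_dvd_monomial]
        simp [expVec_apply]
      have h3 : X v ∣ L :=
        ((X_prime (i := v)).dvd_or_dvd h2).resolve_right (not_X_dvd_affPoly d v h0)
      obtain ⟨q, rfl⟩ := h3
      rw [mem_support_iff, coeff_X_mul'] at hm
      have : v ∈ m.support := by
        by_contra h'
        simp [h'] at hm
      simpa [expVec_apply] using Nat.one_le_iff_ne_zero.2 (Finsupp.mem_support_iff.1 this)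
  have hL : L = monomial (expVec 1) (coeff (expVec 1) L) := by
    ext m
    rw [coeff_monomial]
    split_ifs with h'
    · rw [h']
    · by_contra h2
      exact h' (hsupp m (mem_support_iff.2 h2)).symm
  refine ⟨coeff (expVec 1) L, fun x => ?_⟩
  have h2 := congrArg (coeff (expVec 1 + expVec x)) h
  rw [hL, coeff_monomial_mul, coeff_monomial_mul, coeff_affPoly, coeff_affPoly] at h2
  simpa using h2

/-- Let `T` be a vector of multi-affine polynomials of constant norm on the torus, with
real nonzero coefficients. If modulating its coefficients by `ψ` gives a vector that is
proportional to `T` at all points of a grid, then `ψ` is constant. -/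
theorem eq_of_proportional {κ : Type*} [Fintype κ] (E : Reg ι → κ → ℂ)
    (hstar : ∀ x y, star (E x y) = E x y) (hE : ∀ x y, E x y ≠ 0)
    (c : ℂ) (hc : c ≠ 0)
    (hnorm : ∀ w : ι → ℂ, (∀ v, w v * star (w v) = 1) →
      ∑ y, (∑ x, E x y * mono w x) * star (∑ x, E x y * mono w x) = c)
    (Z : Finset ℂ) (hZ : ∀ z ∈ Z, z * star z = 1) (hcard : 3 < Z.card) (ψ : Reg ι → ℂ)
    (hprop : ∀ w : ι → ℂ, (∀ v, w v ∈ Z) → ∀ y y',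
      (∑ x, E x y * ψ x * mono w x) * (∑ x, E x y' * mono w x) =
      (∑ x, E x y' * ψ x * mono w x) * ∑ x, E x y * mono w x) (x x' : Reg ι) :
    ψ x = ψ x' := by
  classical
  obtain ⟨y⟩ : Nonempty κ := by
    by_contra h
    rw [not_nonempty_iff] at h
    exact hc (by simpa using (hnorm (fun _ => 1) (by simp)).symm)
  -- On the torus, `L` is `X^1` times the factor `⟨T, F⟩ / c` between the modulated vector `F` and
  -- `T`; the conjugate of `T` is made polynomial by reversing the labels.
  set L : MvPolynomial ι ℂ := C c⁻¹ * ∑ y', affPoly (fun x => E (x + 1) y') *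
    affPoly (fun x => E x y' * ψ x) with hL
  have key : monomial (expVec 1) 1 * affPoly (fun x => E x y * ψ x) =
      L * affPoly (fun x => E x y) := by
    rw [← sub_eq_zero]
    -- All degrees are at most `3`, so that the identity can be checked on the grid.
    refine eq_zero_of_eval_zero_at_prod_finset _ (fun _ => Z) (fun v => ?_) fun w hw => ?_
    · refine lt_of_le_of_lt ?_ hcard
      refine (degreeOf_sub_le _ _ _).trans (max_le ?_ ?_)
      · refine (degreeOf_mul_le _ _ _).trans (?_ : _ ≤ 1 + 2)
        refine add_le_add ?_ ((degreeOf_affPoly_le _ v).trans (by norm_num))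
        rw [degreeOf_monomial_eq _ _ one_ne_zero]
        simp [expVec_apply]
      · refine (degreeOf_mul_le _ _ _).trans (?_ : _ ≤ 2 + 1)
        refine add_le_add ?_ (degreeOf_affPoly_le _ v)
        refine (degreeOf_C_mul_le _ _ _).trans ((degreeOf_sum_le _ _ _).trans
          (Finset.sup_le fun y' _ => ?_))
        exact (degreeOf_mul_le _ _ _).trans
          (add_le_add (degreeOf_affPoly_le _ v) (degreeOf_affPoly_le _ v))
    · have hw1 : ∀ v, w v * star (w v) = 1 := fun v => hZ _ (hw v)
      have hrev : ∀ y', (∑ x, E (x + 1) y' * mono w x) =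
          mono w 1 * star (∑ x, E x y' * mono w x) := by
        intro y'
        rw [star_sum, Finset.mul_sum, ← Equiv.sum_comp (Equiv.addRight 1)]
        refine Finset.sum_congr rfl fun x _ => ?_
        have hx : x + 1 + 1 = x := by
          ext v
          simp [add_assoc, fin_two_cancel]
        simp only [Equiv.coe_addRight, hx, star_mul', hstar, ← mono_reverse w hw1]
        ring
      simp only [hL, map_sub, map_mul, map_sum, eval_C, eval_affPoly, eval_monomial_expVec, hrev]
      have h1 := hnorm w hw1
      have h2 : (∑ y', mono w 1 * star (∑ x, E x y' * mono w x) * ∑ x, E x y' * ψ x * mono w x) *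
          (∑ x, E x y * mono w x) = mono w 1 * (∑ x, E x y * ψ x * mono w x) * c := by
        rw [← h1, Finset.sum_mul, Finset.mul_sum]
        refine Finset.sum_congr rfl fun y' _ => ?_
        linear_combination (-mono w 1 * star (∑ x, E x y' * mono w x)) * hprop w hw y y'
      rw [mul_assoc c⁻¹, h2]
      field_simp
      ring
  obtain ⟨κ, hκ⟩ := affPoly_proportional _ _ (hE 0 y) (hE 1 y) L key
  have : ∀ x, ψ x = κ := fun x => mul_left_cancel₀ (hE x y) (by rw [hκ x, mul_comm])
  rw [this, this]

end

open scoped ComplexOrder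

/-! ### States that give the correct result -/

theorem IsCompletelyPositive.posSemidef {a b : Type*} {Λ : Op a →ₗ[ℂ] Op b}
    (h : IsCompletelyPositive Λ) {X : Op a} (hX : X.PosSemidef) : (Λ X).PosSemidef :=
  (h 1 (X.submatrix Prod.snd Prod.snd) (hX.submatrix _)).submatrix fun i => ((0 : Fin 1), i)

theorem proj_posSemidef {a : Type*} [Finite a] (ψ : a → ℂ) : (proj ψ).PosSemidef :=
  Matrix.posSemidef_vecMulVec_self_star ψ

section

variable {V : Type*} [Fintype V] [DecidableEq V] {P : Pattern V} {S : Finset P.Measured} {k : ℕ}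

theorem Client.nodeState_posSemidef (C : Client P S k)
    {Λ : Op (Reg (Fin k)) →ₗ[ℂ] Op (Reg {v : P.Measured // v ∈ S})} (hΛ : IsChannel Λ) (ω : C.Ω) :
    (C.nodeState Λ ω).PosSemidef := by
  have h := ((hΛ.1.posSemidef (proj_posSemidef _ : (C.resource ω).PosSemidef)).kronecker
    (C.τ_state ω).1).submatrix
      fun x : Reg P.Measured => ((fun v : {v : P.Measured // v ∈ S} => x v),
        fun v : {v : P.Measured // v ∉ S} => x v)
  exact h

/-- The correct result is a pure state: a vector orthogonal to the amplitudes of the branch with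
outcomes `0` is in its kernel. -/
theorem Pattern.target_mulVec_eq_zero (P : Pattern V) (φ : Angles P) (u : Reg P.Out → ℂ)
    (hu : star (P.amp (fun v => star (phase (P.angle φ v))) 1) ⬝ᵥ u = 0) :
    (P.target φ).mulVec u = 0 := by
  rw [target, P.execute_eq, Matrix.sum_mulVec]
  refine Finset.sum_eq_zero fun b _ => ?_
  obtain ⟨κ, hκ⟩ := P.exists_branch_plus φ b
  have h : (P.branch φ (fun _ => 0) (fun _ => false) b).mulVec (prodKet fun _ => ketPlus 0) =
      κ • P.amp (fun v => star (phase (P.angle φ v))) 1 := funext hκ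
  rw [proj_conj, h, proj, Matrix.vecMulVec_mulVec, star_smul, smul_dotProduct, hu]
  simp

/-- In a complete protocol, the branch with outcomes `0` maps every column of the state of the
measured nodes to the line spanned by the correct result, because the correct result is pure. -/
theorem Client.Complete.amp_proportional {C : Client P S k}
    {Λ : Op (Reg (Fin k)) →ₗ[ℂ] Op (Reg {v : P.Measured // v ∈ S})} (hC : C.Complete Λ)
    (hΛ : IsChannel Λ) (ω : C.Ω) (hω : C.p ω ≠ 0) (φ : Angles P) (x₀ : Reg P.Measured)
    (y y' : Reg P.Out) :
    P.amp (fun v => star (phase (P.angle φ v)))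
        (fun x => mono (fun v => star (phase (C.α ω v))) x * C.nodeState Λ ω x x₀) y *
      P.amp (fun v => star (phase (P.angle φ v))) 1 y' =
    P.amp (fun v => star (phase (P.angle φ v)))
        (fun x => mono (fun v => star (phase (C.α ω v))) x * C.nodeState Λ ω x x₀) y' *
      P.amp (fun v => star (phase (P.angle φ v))) 1 y := by
  classical
  set t := P.amp (fun v => star (phase (P.angle φ v))) 1 with ht
  set u : Reg P.Out → ℂ := star (t y') • Pi.single y 1 - star (t y) • Pi.single y' 1 with hu
  have htu : star t ⬝ᵥ u = 0 := by
    rw [hu, dotProduct_sub, dotProduct_smul, dotProduct_smul, dotProduct_single_one,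
      dotProduct_single_one]
    simp [mul_comm]
  set B := P.branch φ (C.α ω) (fun _ => false) (fun _ => false) with hB
  set ρ := C.nodeState Λ ω with hρ
  have hpos : ∀ ω r b, 0 ≤ star u ⬝ᵥ (P.branch φ (C.α ω) r b * C.nodeState Λ ω *
      (P.branch φ (C.α ω) r b).conjTranspose).mulVec u := fun ω r b =>
    ((C.nodeState_posSemidef hΛ ω).mul_mul_conjTranspose_same _).dotProduct_mulVec_nonneg u
  have hcoef : ∀ ω, 0 ≤ ((C.p ω / 2 ^ Fintype.card P.Measured : ℝ) : ℂ) := fun ω => by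
    rw [Complex.zero_le_real]
    exact div_nonneg (C.p_nonneg ω) (by positivity)
  have hsum : ∑ ω, ∑ r : P.Measured → Bool, ∑ b : P.Measured → Bool,
      ((C.p ω / 2 ^ Fintype.card P.Measured : ℝ) : ℂ) *
      (star u ⬝ᵥ (P.branch φ (C.α ω) r b * C.nodeState Λ ω *
        (P.branch φ (C.α ω) r b).conjTranspose).mulVec u) = 0 := by
    have h := congrArg (fun M : Op (Reg P.Out) => star u ⬝ᵥ M.mulVec u) (hC φ)
    simp only [P.target_mulVec_eq_zero φ u htu, dotProduct_zero, P.execute_eq, Matrix.sum_mulVec,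
      Matrix.smul_mulVec, dotProduct_sum, dotProduct_smul, smul_eq_mul, Finset.mul_sum] at h
    exact h
  have hzero : star u ⬝ᵥ (B * ρ * B.conjTranspose).mulVec u = 0 := by
    rw [Finset.sum_eq_zero_iff_of_nonneg fun ω _ => Finset.sum_nonneg fun r _ =>
      Finset.sum_nonneg fun b _ => mul_nonneg (hcoef ω) (hpos ω r b)] at hsum
    have h1 := hsum ω (Finset.mem_univ _)
    rw [Finset.sum_eq_zero_iff_of_nonneg fun r _ =>
      Finset.sum_nonneg fun b _ => mul_nonneg (hcoef ω) (hpos ω r b)] at h1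
    have h2 := h1 (fun _ => false) (Finset.mem_univ _)
    rw [Finset.sum_eq_zero_iff_of_nonneg fun b _ => mul_nonneg (hcoef ω) (hpos ω _ b)] at h2
    refine (mul_eq_zero.1 (h2 (fun _ => false) (Finset.mem_univ _))).resolve_left ?_
    exact_mod_cast div_ne_zero hω (by positivity)
  have hker : ρ.mulVec (B.conjTranspose.mulVec u) = 0 := by
    rw [← (C.nodeState_posSemidef hΛ ω).dotProduct_mulVec_zero_iff, Matrix.star_mulVec,
      Matrix.conjTranspose_conjTranspose, ← Matrix.dotProduct_mulVec, Matrix.mulVec_mulVec,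
      Matrix.mulVec_mulVec]
    exact hzero
  have hcol : star u ⬝ᵥ B.mulVec (fun x => ρ x x₀) = 0 := by
    have h := congrFun (congrArg star hker) x₀
    rw [Matrix.star_mulVec, (C.nodeState_posSemidef hΛ ω).1.eq, Matrix.star_mulVec,
      Matrix.conjTranspose_conjTranspose] at h
    rw [Matrix.dotProduct_mulVec]
    exact h.trans (by simp)
  have hBcol : B.mulVec (fun x => ρ x x₀) = fun y =>
      ((Real.sqrt 2)⁻¹ : ℂ) ^ Fintype.card P.Out *
      ((Real.sqrt 2)⁻¹ : ℂ) ^ Fintype.card P.Measured *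
      P.amp (fun v => star (phase (P.angle φ v)))
        (fun x => mono (fun v => star (phase (C.α ω v))) x * ρ x x₀) y :=
    funext fun y => P.branch_false_mulVec φ (C.α ω) _ y
  have hconst : ((Real.sqrt 2)⁻¹ : ℂ) ^ Fintype.card P.Out *
      ((Real.sqrt 2)⁻¹ : ℂ) ^ Fintype.card P.Measured ≠ 0 := by
    have : ((Real.sqrt 2 : ℝ) : ℂ) ≠ 0 := by
      exact_mod_cast (Real.sqrt_pos.2 two_pos).ne'
    positivity
  have hsu : star u = t y' • Pi.single y 1 - t y • Pi.single y' 1 := by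
    rw [hu, star_sub, star_smul, star_smul, star_star, star_star, ← Pi.single_star,
      ← Pi.single_star, star_one]
  rw [hBcol, hsu, sub_dotProduct, smul_dotProduct, smul_dotProduct, single_one_dotProduct,
    single_one_dotProduct, smul_eq_mul, smul_eq_mul] at hcol
  refine mul_left_cancel₀ hconst ?_
  linear_combination hcol

theorem phase_octant_injective :
    Function.Injective fun j : Fin 8 => phase ((((j : ℕ) * (Real.pi / 4) : ℝ) : Real.Angle)) := by
  intro i j h
  have hz : ∀ j : Fin 8, phase ((((j : ℕ) * (Real.pi / 4) : ℝ) : Real.Angle)) =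
      Complex.exp (2 * Real.pi * Complex.I / (8 : ℕ)) ^ (j : ℕ) := by
    intro j
    rw [phase_coe, ← Complex.exp_nat_mul]
    congr 1
    push_cast
    ring
  simp only [hz] at h
  exact Fin.ext ((Complex.isPrimitiveRoot_exp 8 (by norm_num)).pow_inj i.2 j.2 h)

/-- In a complete protocol, every column of the state of the measured nodes is a multiple of
`⨂ |+_{α_v}⟩`. -/
theorem Client.Complete.nodeState_column {C : Client P S k}
    {Λ : Op (Reg (Fin k)) →ₗ[ℂ] Op (Reg {v : P.Measured // v ∈ S})} (hC : C.Complete Λ)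
    (hΛ : IsChannel Λ) (ω : C.Ω) (hω : C.p ω ≠ 0) (x₀ x : Reg P.Measured) :
    C.nodeState Λ ω x x₀ = mono (fun v => phase (C.α ω v)) x * C.nodeState Λ ω 0 x₀ := by
  classical
  have h := eq_of_proportional (fun x y => P.edgeSign (P.glue x y))
    (fun x y => P.star_edgeSign _) (fun x y => left_ne_zero_of_mul_eq_one (P.edgeSign_sq _))
    (2 ^ Fintype.card V) (by positivity)
    (fun w hw => by
      have := P.sum_amp_mul_star w hw
      simpa [Pattern.amp, mul_comm, -RCLike.star_def] using this)
    (Finset.univ.image fun j : Fin 8 =>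
      star (phase ((((j : ℕ) * (Real.pi / 4) : ℝ) : Real.Angle))))
    (fun z hz => by
      obtain ⟨j, -, rfl⟩ := Finset.mem_image.1 hz
      rw [star_star, mul_comm, phase_mul_star])
    (lt_of_lt_of_eq (by simp)
      (Finset.card_image_of_injective _ (star_injective.comp phase_octant_injective)).symm)
    (fun x => mono (fun v => star (phase (C.α ω v))) x * C.nodeState Λ ω x x₀)
    (fun w hw y y' => by
      choose φ _ hφ using fun v => Finset.mem_image.1 (hw v)
      have := hC.amp_proportional hΛ ω hω φ x₀ y y'
      have hw' : (fun v => star (phase (P.angle φ v))) = w := funext hφ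
      rw [hw'] at this
      have e1 : ∀ (ψ : Reg P.Measured → ℂ) y,
          ∑ x, P.edgeSign (P.glue x y) * ψ x * mono w x = P.amp w ψ y := fun ψ y =>
        Finset.sum_congr rfl fun x _ => by ring
      have e2 : ∀ y, ∑ x, P.edgeSign (P.glue x y) * mono w x = P.amp w 1 y := fun y =>
        Finset.sum_congr rfl fun x _ => by rw [Pi.one_apply]; ring
      rw [e1, e1, e2, e2]
      exact this) x 0
  have h0 : mono (fun v => star (phase (C.α ω v))) 0 = 1 := by simp [mono]
  have h1 := mono_mul_star (fun v => phase (C.α ω v)) (fun v => phase_mul_star _) x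
  have h2 : mono (fun v => star (phase (C.α ω v))) x =
      star (mono (fun v => phase (C.α ω v)) x) := by
    simp only [mono, star_prod]
    refine Finset.prod_congr rfl fun v _ => ?_
    split_ifs <;> simp
  rw [h0, h2] at h
  linear_combination (mono (fun v => phase (C.α ω v)) x) * h - C.nodeState Λ ω x x₀ * h1

theorem Client.Complete.nodeState_eq {C : Client P S k}
    {Λ : Op (Reg (Fin k)) →ₗ[ℂ] Op (Reg {v : P.Measured // v ∈ S})} (hC : C.Complete Λ)
    (hΛ : IsChannel Λ) (ω : C.Ω) (hω : C.p ω ≠ 0) (x x' : Reg P.Measured) :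
    C.nodeState Λ ω x x' = mono (fun v => phase (C.α ω v)) x *
      star (mono (fun v => phase (C.α ω v)) x') * C.nodeState Λ ω 0 0 := by
  have hherm := (C.nodeState_posSemidef hΛ ω).1
  rw [hC.nodeState_column hΛ ω hω x' x, ← hherm.apply 0 x', hC.nodeState_column hΛ ω hω 0 x',
    star_mul', hherm.apply 0 0, mul_assoc]

/-- In a complete protocol, the channel prepares `⨂ |+_{α_v}⟩` on the nodes of `S`. -/
theorem Client.Complete.channel_resource {C : Client P S k}
    {Λ : Op (Reg (Fin k)) →ₗ[ℂ] Op (Reg {v : P.Measured // v ∈ S})} (hC : C.Complete Λ)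
    (hΛ : IsChannel Λ) (ω : C.Ω) (hω : C.p ω ≠ 0) (a b : Reg {v : P.Measured // v ∈ S}) :
    2 ^ S.card * Λ (C.resource ω) a b =
      mono (fun v : {v : P.Measured // v ∈ S} => phase (C.α ω v)) a *
      star (mono (fun v : {v : P.Measured // v ∈ S} => phase (C.α ω v)) b) := by
  classical
  let ext (a : Reg {v : P.Measured // v ∈ S}) (c : Reg {v : P.Measured // v ∉ S}) :
    Reg P.Measured := fun v => if h : v ∈ S then a ⟨v, h⟩ else c ⟨v, h⟩
  have hstate : ∀ a b c d, C.nodeState Λ ω (ext a c) (ext b d) =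
      Λ (C.resource ω) a b * C.τ ω c d := by
    intro a b c d
    have h1 : ∀ a c, (fun v : {v : P.Measured // v ∈ S} => ext a c v) = a := fun a c =>
      funext fun v => by simp [ext, v.2]
    have h2 : ∀ a c, (fun v : {v : P.Measured // v ∉ S} => ext a c v) = c := fun a c =>
      funext fun v => by simp [ext, v.2]
    simp only [nodeState, Matrix.of_apply, h1, h2]
  have hmono : ∀ a c, mono (fun v => phase (C.α ω v)) (ext a c) =
      mono (fun v : {v : P.Measured // v ∈ S} => phase (C.α ω v)) a *
      mono (fun v : {v : P.Measured // v ∉ S} => phase (C.α ω v)) c := by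
    intro a c
    have h := Fintype.prod_subtype_mul_prod_subtype (fun v => v ∈ S)
      (fun v => if ext a c v = 1 then phase (C.α ω v) else 1)
    rw [mono, ← h]
    congr 1
    · rw [mono]
      convert rfl using 3 with v
      simp [ext, v.2]
    · rw [mono]
      refine Finset.prod_congr rfl fun v _ => ?_
      simp [ext, v.2]
  set K := ∑ c : Reg {v : P.Measured // v ∉ S}, C.nodeState Λ ω 0 0 with hK
  have hΛres : ∀ a b, Λ (C.resource ω) a b =
      mono (fun v : {v : P.Measured // v ∈ S} => phase (C.α ω v)) a *
      star (mono (fun v : {v : P.Measured // v ∈ S} => phase (C.α ω v)) b) * K := by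
    intro a b
    have htr : ∑ c, C.τ ω c c = 1 := (C.τ_state ω).2
    rw [← mul_one (Λ (C.resource ω) a b), ← htr, Finset.mul_sum, hK, Finset.mul_sum]
    refine Finset.sum_congr rfl fun c _ => ?_
    rw [← hstate, hC.nodeState_eq hΛ ω hω, hmono, hmono, star_mul']
    have := mono_mul_star (fun v : {v : P.Measured // v ∉ S} => phase (C.α ω v))
      (fun v => phase_mul_star _) c
    linear_combination (mono (fun v : {v : P.Measured // v ∈ S} => phase (C.α ω v)) a *
      star (mono (fun v : {v : P.Measured // v ∈ S} => phase (C.α ω v)) b) *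
      C.nodeState Λ ω 0 0) * this
  have hres : (C.resource ω).trace = 1 := by
    simp only [resource, proj, Matrix.trace, Matrix.diag, Matrix.vecMulVec_apply, Pi.star_apply,
      prodKet, star_prod, ← Finset.prod_mul_distrib]
    have h := Finset.prod_univ_sum (fun _ : Fin k => (Finset.univ : Finset (Fin 2)))
      (fun i a => ketPlus (C.θ ω i) a * star (ketPlus (C.θ ω i) a))
    rw [Fintype.piFinset_univ] at h
    rw [← h]
    refine Finset.prod_eq_one fun i _ => ?_
    have h2 : ((Real.sqrt 2 : ℝ) : ℂ) * (Real.sqrt 2 : ℝ) = 2 := by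
      exact_mod_cast Real.mul_self_sqrt two_pos.le
    have h3 : ((Real.sqrt 2 : ℝ) : ℂ)⁻¹ * ((Real.sqrt 2 : ℝ) : ℂ)⁻¹ = 1 / 2 := by
      rw [← mul_inv, h2, one_div]
    have h4 : phase (C.θ ω i) * (starRingEnd ℂ) (phase (C.θ ω i)) = 1 := phase_mul_star _
    simp [ketPlus, ketXY_apply]
    linear_combination (2 : ℂ) * h3 +
      (((Real.sqrt 2 : ℝ) : ℂ)⁻¹ * ((Real.sqrt 2 : ℝ) : ℂ)⁻¹) * h4
  have hKval : 2 ^ S.card * K = 1 := by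
    have h := hΛ.2 (C.resource ω)
    rw [hres, Matrix.trace] at h
    simp only [Matrix.diag, hΛres, mono_mul_star _ (fun v => phase_mul_star _), one_mul] at h
    simpa using h
  rw [hΛres]
  linear_combination (mono (fun v : {v : P.Measured // v ∈ S} => phase (C.α ω v)) a *
      star (mono (fun v : {v : P.Measured // v ∈ S} => phase (C.α ω v)) b)) * hKval

end

/-! ### Blindness makes the secret angles uniform -/

theorem isCompletelyPositive_id {a : Type*} :
    IsCompletelyPositive (LinearMap.id : Op a →ₗ[ℂ] Op a) := fun _ _ hX => hX

theorem isCompletelyPositive_zero {a : Type*} :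
    IsCompletelyPositive (0 : Op a →ₗ[ℂ] Op a) := fun _ _ _ => Matrix.PosSemidef.zero

/-- The server that stores everything it receives, does nothing and always answers `0`. -/
noncomputable def storingServer (R : Type*) [Fintype R] : Server R R where
  load := LinearMap.id
  load_channel := ⟨isCompletelyPositive_id, fun _ => rfl⟩
  step _ _ b := if b then 0 else LinearMap.id
  step_cp _ _ b := by
    cases b
    · simpa using isCompletelyPositive_id
    · simpa using isCompletelyPositive_zero
  step_tp _ _ X := by simp

theorem storingServer_rounds {R : Type*} [Fintype R] (h l : List (Real.Angle × Bool)) (X : Op R)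
    (hl : ∀ q ∈ l, q.2 = false) : (storingServer R).rounds h l X = X := by
  induction l generalizing h X with
  | nil => rfl
  | cons q l ih =>
    obtain ⟨δ, b⟩ := q
    obtain rfl : b = false := hl (δ, b) (by simp)
    rw [Server.rounds, ih _ _ fun q hq => hl q (by simp [hq])]
    simp [storingServer]

/-- The character `e^{2 i n·δ}` of tuples of angles. -/
noncomputable def evenChar {ι : Type*} [Fintype ι] (n : ι → ℤ) (δ : ι → Real.Angle) : ℂ :=
  ∏ v, (phase (δ v) ^ 2) ^ n v

section

variable {V : Type*} [Fintype V] [DecidableEq V] {P : Pattern V} {S : Finset P.Measured} {k : ℕ}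

/-- For angles that are multiples of `π/2`, the even characters of the announced angles do not
depend on the secret bits and on the outcomes. -/
theorem Pattern.evenChar_announced (P : Pattern V) (n : P.Measured → ℤ) (φ : Angles P)
    (α : P.Measured → Real.Angle) (r b : P.Measured → Bool)
    (hφ : ∀ v, phase (-P.angle φ v) ^ 2 = phase (P.angle φ v) ^ 2) :
    evenChar n (P.announced φ α r b) = evenChar n (P.angle φ) * evenChar n α := by
  classical
  rw [evenChar, evenChar, evenChar, ← Finset.prod_mul_distrib]
  refine Finset.prod_congr rfl fun v _ => ?_
  rw [← mul_zpow]
  congr 1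
  simp only [announced, P.corrected_eq, phase_add, mul_pow]
  split_ifs <;> simp [phase_pi, phase_zero, hφ v]

open scoped Classical in
theorem Client.sum_evenChar_view (C : Client P S k) (n : P.Measured → ℤ) (φ : Angles P)
    (hφ : ∀ v, phase (-P.angle φ v) ^ 2 = phase (P.angle φ v) ^ 2)
    (D : Finset (P.Measured → Real.Angle))
    (hD : ∀ ω r, P.announced φ (C.α ω) r (fun _ => false) ∈ D) :
    ∑ δ ∈ D, evenChar n δ • C.view (storingServer C.Sent) φ δ (fun _ => false) =
      evenChar n (P.angle φ) • ∑ ω, ((C.p ω : ℂ) * evenChar n (C.α ω)) • C.sentState ω := by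
  simp only [view, Finset.smul_sum]
  rw [Finset.sum_comm]
  refine Finset.sum_congr rfl fun ω _ => ?_
  rw [Finset.sum_comm]
  have h : ∀ r : P.Measured → Bool, ∑ δ ∈ D, evenChar n δ •
      (if P.announced φ (C.α ω) r (fun _ => false) = δ then
        ((C.p ω / 2 ^ Fintype.card P.Measured : ℝ) : ℂ) • (storingServer C.Sent).rounds []
          (List.ofFn fun t => (δ (P.order t), false))
          ((storingServer C.Sent).load (C.sentState ω)) else 0) =
      (evenChar n (P.angle φ) * evenChar n (C.α ω) *
        ((C.p ω / 2 ^ Fintype.card P.Measured : ℝ) : ℂ)) • C.sentState ω := by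
    intro r
    rw [Finset.sum_eq_single_of_mem _ (hD ω r) fun δ _ hδ => by rw [if_neg hδ.symm, smul_zero],
      if_pos rfl, storingServer_rounds _ _ _ (by simp [List.mem_ofFn]),
      P.evenChar_announced n φ _ _ _ hφ, smul_smul]
    rfl
  rw [Finset.sum_congr rfl fun r _ => h r, Finset.sum_const, ← Nat.cast_smul_eq_nsmul ℂ, smul_smul,
    smul_smul]
  congr 1
  simp only [Finset.card_univ, Fintype.card_fun, Fintype.card_bool]
  push_cast
  field_simp

/-- In a blind protocol, the states that are sent, weighted by a nontrivial character of the secret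
angles, add up to zero: otherwise the view of the storing server would distinguish the computation
with all angles `0` from the one in which one angle is `π/2`. -/
theorem Client.Blind.sum_sentState_eq_zero {C : Client P S k} (hC : C.Blind)
    (n : P.Measured → ℤ) (v₀ : P.Measured) (hn : Odd (n v₀)) :
    ∑ ω, ((C.p ω : ℂ) * evenChar n (C.α ω)) • C.sentState ω = 0 := by
  classical
  set φ₀ : Angles P := fun _ => 0 with hφ₀
  set φ₁ : Angles P := Pi.single v₀ 2 with hφ₁
  have ha₀ : ∀ v, P.angle φ₀ v = 0 := fun v => by simp [hφ₀, Pattern.angle]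
  have ha₁ : ∀ v, v ≠ v₀ → P.angle φ₁ v = 0 := fun v hv => by
    simp [hφ₁, Pattern.angle, hv]
  have ha₁' : phase (P.angle φ₁ v₀) = Complex.I := by
    rw [Pattern.angle, phase_coe]
    simp only [hφ₁, Pi.single_eq_same]
    rw [← Complex.exp_pi_div_two_mul_I]
    congr 1
    push_cast
    simp
    ring
  have h₀ : ∀ v, phase (-P.angle φ₀ v) ^ 2 = phase (P.angle φ₀ v) ^ 2 := fun v => by simp [ha₀]
  have h₁ : ∀ v, phase (-P.angle φ₁ v) ^ 2 = phase (P.angle φ₁ v) ^ 2 := fun v => by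
    by_cases hv : v = v₀
    · subst hv
      rw [← star_phase, ha₁']
      simp
    · simp [ha₁ v hv]
  have hc₀ : evenChar n (P.angle φ₀) = 1 := by simp [evenChar, ha₀, phase_zero]
  have hc₁ : evenChar n (P.angle φ₁) = -1 := by
    rw [evenChar, Finset.prod_eq_single v₀ (fun v _ hv => by simp [ha₁ v hv, phase_zero]) (by simp),
      ha₁', Complex.I_sq, hn.neg_one_zpow]
  obtain ⟨D, hD₀, hD₁⟩ : ∃ D : Finset (P.Measured → Real.Angle),
      (∀ ω r, P.announced φ₀ (C.α ω) r (fun _ => false) ∈ D) ∧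
      ∀ ω r, P.announced φ₁ (C.α ω) r (fun _ => false) ∈ D := by
    refine ⟨Finset.univ.biUnion fun ω => Finset.univ.biUnion fun r =>
      {P.announced φ₀ (C.α ω) r (fun _ => false), P.announced φ₁ (C.α ω) r (fun _ => false)},
      fun ω r => ?_, fun ω r => ?_⟩
    · simp only [Finset.mem_biUnion]
      exact ⟨ω, Finset.mem_univ _, r, Finset.mem_univ _, Finset.mem_insert_self _ _⟩
    · simp only [Finset.mem_biUnion]
      exact ⟨ω, Finset.mem_univ _, r, Finset.mem_univ _,
        Finset.mem_insert_of_mem (Finset.mem_singleton_self _)⟩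
  have e₀ := C.sum_evenChar_view n φ₀ h₀ D hD₀
  have e₁ := C.sum_evenChar_view n φ₁ h₁ D hD₁
  rw [hC _ (storingServer C.Sent) φ₀ φ₁, e₁, hc₀, hc₁, one_smul, neg_one_smul] at e₀
  ext x y
  have h := congrFun (congrFun e₀ x) y
  rw [Matrix.neg_apply] at h
  rw [Matrix.zero_apply]
  linear_combination (-1 / 2 : ℂ) * h

theorem Client.Blind.sum_resource_eq_zero {C : Client P S k} (hC : C.Blind)
    (n : P.Measured → ℤ) (v₀ : P.Measured) (hn : Odd (n v₀)) :
    ∑ ω, ((C.p ω : ℂ) * evenChar n (C.α ω)) • C.resource ω = 0 := by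
  classical
  ext x y
  have h := hC.sum_sentState_eq_zero n v₀ hn
  have h1 : ∑ c, ∑ ω, ((C.p ω : ℂ) * evenChar n (C.α ω)) * (C.resource ω x y * C.τ ω c c) = 0 := by
    refine Finset.sum_eq_zero fun c _ => ?_
    have := congrFun (congrFun h (x, c)) (y, c)
    simpa [Matrix.sum_apply, sentState] using this
  rw [Finset.sum_comm] at h1
  simp only [← Finset.mul_sum] at h1
  have htr : ∀ ω, ∑ c, C.τ ω c c = 1 := fun ω => (C.τ_state ω).2
  simp only [htr, mul_one] at h1
  simpa [Matrix.sum_apply] using h1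

/-! ### Counting -/

/-- The functions `1, e^{iθ}, e^{-iθ}`, which span the matrix elements of `|+_θ⟩⟨+_θ|`. -/
noncomputable def triChar (θ : Real.Angle) : Fin 3 → ℂ := ![1, phase θ, star (phase θ)]

/-- A difference of two exponents in `{-1, 0, 1}` is `2n + a - b` with `a, b ∈ {0, 1}`, where `n` is
odd unless the exponents agree. -/
theorem exists_triChar_mul_star (m m' : Fin 3) : ∃ (n : ℤ) (a b : Fin 2), (m ≠ m' → Odd n) ∧
    ∀ θ, triChar θ m * star (triChar θ m') = (phase θ ^ 2) ^ n *
      ((if a = 1 then phase θ else 1) * star (if b = 1 then phase θ else 1)) := by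
  have hs : ∀ θ, star (phase θ) = (phase θ)⁻¹ := fun θ =>
    eq_inv_of_mul_eq_one_right (phase_mul_star θ)
  have h0 := phase_ne_zero
  fin_cases m <;> fin_cases m'
  · exact ⟨0, 0, 0, by simp, fun θ => by simp [triChar]⟩
  · exact ⟨-1, 1, 0, by simp, fun θ => by simp [triChar, hs, -RCLike.star_def]; field_simp [h0 θ]⟩
  · exact ⟨1, 0, 1, by simp, fun θ => by simp [triChar, hs, -RCLike.star_def]; field_simp [h0 θ]⟩
  · exact ⟨1, 0, 1, by simp, fun θ => by simp [triChar, hs, -RCLike.star_def]; field_simp [h0 θ]⟩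
  · exact ⟨0, 0, 0, by simp, fun θ => by simp [triChar, hs, -RCLike.star_def, h0 θ]⟩
  · exact ⟨1, 0, 0, by simp, fun θ => by simp [triChar, hs, -RCLike.star_def]; ring⟩
  · exact ⟨-1, 1, 0, by simp, fun θ => by simp [triChar, hs, -RCLike.star_def]; field_simp [h0 θ]⟩
  · exact ⟨-1, 0, 0, by simp, fun θ => by simp [triChar, hs, -RCLike.star_def]; field_simp [h0 θ]⟩
  · exact ⟨0, 0, 0, by simp, fun θ => by simp [triChar, hs, -RCLike.star_def, h0 θ]⟩

theorem exists_ketPlus_mul_star (a b : Fin 2) : ∃ m : Fin 3, ∀ θ,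
    ketPlus θ a * star (ketPlus θ b) = ((Real.sqrt 2)⁻¹ : ℂ) ^ 2 * triChar θ m := by
  fin_cases a <;> fin_cases b
  · exact ⟨0, fun θ => by simp [ketPlus, ketXY_apply, triChar]; ring⟩
  · exact ⟨2, fun θ => by simp [ketPlus, ketXY_apply, triChar]; ring⟩
  · exact ⟨1, fun θ => by simp [ketPlus, ketXY_apply, triChar]; ring⟩
  · refine ⟨0, fun θ => ?_⟩
    have : phase θ * (starRingEnd ℂ) (phase θ) = 1 := phase_mul_star θ
    simp [ketPlus, ketXY_apply, triChar]
    linear_combination ((Real.sqrt 2 : ℝ) : ℂ)⁻¹ ^ 2 * this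

/-- Orthonormality of the characters of the secret angles in `S`. The product of a character and the
conjugate of another one is an even character, odd at a node where the two differ, times a matrix
element of the output of the channel, so that blindness makes its mean vanish. -/
theorem Client.sum_triChar_mul_star {C : Client P S k}
    {Λ : Op (Reg (Fin k)) →ₗ[ℂ] Op (Reg {v : P.Measured // v ∈ S})} (hΛ : IsChannel Λ)
    (hC : C.Complete Λ) (hB : C.Blind) (q q' : {v : P.Measured // v ∈ S} → Fin 3) :
    ∑ ω, (C.p ω : ℂ) * ((∏ v : {v : P.Measured // v ∈ S}, triChar (C.α ω v) (q v)) *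
      star (∏ v : {v : P.Measured // v ∈ S}, triChar (C.α ω v) (q' v))) =
      if q = q' then 1 else 0 := by
  classical
  split_ifs with h
  · subst h
    have h1 : ∀ ω, (∏ v : {v : P.Measured // v ∈ S}, triChar (C.α ω v) (q v)) *
        star (∏ v : {v : P.Measured // v ∈ S}, triChar (C.α ω v) (q v)) = 1 := by
      intro ω
      rw [star_prod, ← Finset.prod_mul_distrib]
      refine Finset.prod_eq_one fun v _ => ?_
      have h2 : phase (C.α ω v) * starRingEnd ℂ (phase (C.α ω v)) = 1 := phase_mul_star _
      generalize q v = m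
      fin_cases m
      · simp [triChar]
      · simp [triChar, h2]
      · simp [triChar, mul_comm, h2]
    simp only [h1, mul_one]
    exact_mod_cast C.p_sum
  · obtain ⟨v₀, hv₀⟩ := Function.ne_iff.1 h
    choose n a b hodd hprod using fun v => exists_triChar_mul_star (q v) (q' v)
    set N : P.Measured → ℤ := fun v => if hv : v ∈ S then n ⟨v, hv⟩ else 0 with hN
    have hres := hB.sum_resource_eq_zero N v₀ (by simpa [hN, v₀.2] using hodd v₀ hv₀)
    have hΛres := congrFun (congrFun (congrArg Λ hres) a) b
    rw [map_sum, map_zero, Matrix.sum_apply] at hΛres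
    have hchar : ∀ ω, evenChar N (C.α ω) =
        ∏ v : {v : P.Measured // v ∈ S}, (phase (C.α ω v) ^ 2) ^ n v := by
      intro ω
      rw [evenChar, ← Finset.prod_subset (Finset.subset_univ S)
        (fun v _ hv => by simp [hN, hv]), ← Finset.prod_coe_sort]
      refine Finset.prod_congr rfl fun v _ => ?_
      simp [hN, v.2]
    have hterm : ∀ ω, (C.p ω : ℂ) *
        ((∏ v : {v : P.Measured // v ∈ S}, triChar (C.α ω v) (q v)) *
          star (∏ v : {v : P.Measured // v ∈ S}, triChar (C.α ω v) (q' v))) =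
        2 ^ S.card * Λ (((C.p ω : ℂ) * evenChar N (C.α ω)) • C.resource ω) a b := by
      intro ω
      by_cases hω : C.p ω = 0
      · simp [hω]
      · have h1 := hC.channel_resource hΛ ω hω a b
        have h2 : (∏ v : {v : P.Measured // v ∈ S}, triChar (C.α ω v) (q v)) *
            star (∏ v : {v : P.Measured // v ∈ S}, triChar (C.α ω v) (q' v)) =
            evenChar N (C.α ω) * (2 ^ S.card * Λ (C.resource ω) a b) := by
          rw [h1, hchar, star_prod, ← Finset.prod_mul_distrib, mono, mono, star_prod,
            ← Finset.prod_mul_distrib, ← Finset.prod_mul_distrib]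
          simp only [hprod]
        rw [h2, map_smul, Matrix.smul_apply, smul_eq_mul]
        ring
    rw [Finset.sum_congr rfl fun ω _ => hterm ω, ← Finset.mul_sum, hΛres]
    simp

/-- The characters of the secret angles in `S` are spanned by the `3 ^ k` characters that appear in
the matrix elements of the resource states. -/
theorem Client.Complete.triChar_mem_span {C : Client P S k}
    {Λ : Op (Reg (Fin k)) →ₗ[ℂ] Op (Reg {v : P.Measured // v ∈ S})} (hC : C.Complete Λ)
    (hΛ : IsChannel Λ) (q : {v : P.Measured // v ∈ S} → Fin 3) :
    (fun ω => (C.p ω : ℂ) * ∏ v : {v : P.Measured // v ∈ S}, triChar (C.α ω v) (q v)) ∈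
      Submodule.span ℂ (Set.range fun (m : Fin k → Fin 3) (ω : C.Ω) =>
        (C.p ω : ℂ) * ∏ i, triChar (C.θ ω i) (m i)) := by
  classical
  choose d hd using exists_ketPlus_mul_star
  have hres : ∀ ω x y, C.resource ω x y =
      (((Real.sqrt 2)⁻¹ : ℂ) ^ 2) ^ k * ∏ i, triChar (C.θ ω i) (d (x i) (y i)) := by
    intro ω x y
    simp only [resource, proj, Matrix.vecMulVec_apply, Pi.star_apply, prodKet, star_prod,
      ← Finset.prod_mul_distrib, hd]
    rw [Finset.prod_mul_distrib]
    simp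
  have htri : ∀ m : Fin 3, ∃ a b : Fin 2, ∀ θ, triChar θ m =
      (if a = 1 then phase θ else 1) * star (if b = 1 then phase θ else 1) := by
    intro m
    fin_cases m
    · exact ⟨0, 0, fun θ => by simp [triChar]⟩
    · exact ⟨1, 0, fun θ => by simp [triChar]⟩
    · exact ⟨0, 1, fun θ => by simp [triChar]⟩
  choose a b hab using fun v => htri (q v)
  have hfun : (fun ω => (C.p ω : ℂ) * ∏ v : {v : P.Measured // v ∈ S}, triChar (C.α ω v) (q v)) =
      ∑ x, ∑ y, (2 ^ S.card * (((Real.sqrt 2)⁻¹ : ℂ) ^ 2) ^ k * Λ (Matrix.single x y 1) a b) •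
        fun ω => (C.p ω : ℂ) * ∏ i, triChar (C.θ ω i) (d (x i) (y i)) := by
    ext ω
    simp only [Finset.sum_apply, Pi.smul_apply, smul_eq_mul]
    by_cases hω : C.p ω = 0
    · simp [hω]
    · have h1 := hC.channel_resource hΛ ω hω a b
      rw [mono, mono, star_prod, ← Finset.prod_mul_distrib] at h1
      simp only [hab]
      rw [← h1, Matrix.matrix_eq_sum_single (C.resource ω), map_sum, Matrix.sum_apply,
        Finset.mul_sum, Finset.mul_sum]
      refine Finset.sum_congr rfl fun x _ => ?_
      rw [map_sum, Matrix.sum_apply, Finset.mul_sum, Finset.mul_sum]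
      refine Finset.sum_congr rfl fun y _ => ?_
      have h2 : Matrix.single x y (C.resource ω x y) =
          C.resource ω x y • Matrix.single x y (1 : ℂ) := by
        rw [Matrix.smul_single, smul_eq_mul, mul_one]
      rw [h2, map_smul, Matrix.smul_apply, smul_eq_mul, hres]
      ring
  rw [hfun]
  refine Submodule.sum_mem _ fun x _ => Submodule.sum_mem _ fun y _ => Submodule.smul_mem _ _ ?_
  exact Submodule.subset_span ⟨fun i => d (x i) (y i), rfl⟩

/-- In a complete and blind protocol, at most as many nodes are served by the server as there
are resource states. -/
theorem Client.card_le {C : Client P S k}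
    {Λ : Op (Reg (Fin k)) →ₗ[ℂ] Op (Reg {v : P.Measured // v ∈ S})} (hΛ : IsChannel Λ)
    (hC : C.Complete Λ) (hB : C.Blind) : S.card ≤ k := by
  classical
  set g : ({v : P.Measured // v ∈ S} → Fin 3) → C.Ω → ℂ := fun q ω =>
    (C.p ω : ℂ) * ∏ v : {v : P.Measured // v ∈ S}, triChar (C.α ω v) (q v) with hg
  have hli : LinearIndependent ℂ g := by
    rw [Fintype.linearIndependent_iff]
    intro c hc q'
    have h1 : ∑ ω, (∑ q, c q • g q) ω *
        star (∏ v : {v : P.Measured // v ∈ S}, triChar (C.α ω v) (q' v)) = 0 := by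
      rw [hc]
      simp
    simp only [Finset.sum_apply, Pi.smul_apply, smul_eq_mul, Finset.sum_mul] at h1
    rw [Finset.sum_comm] at h1
    simp only [hg, mul_assoc, ← Finset.mul_sum, C.sum_triChar_mul_star hΛ hC hB] at h1
    simpa using h1
  have hle : Submodule.span ℂ (Set.range g) ≤ Submodule.span ℂ
      (Set.range fun (m : Fin k → Fin 3) (ω : C.Ω) =>
        (C.p ω : ℂ) * ∏ i, triChar (C.θ ω i) (m i)) := by
    rw [Submodule.span_le]
    rintro _ ⟨q, rfl⟩
    exact hC.triChar_mem_span hΛ q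
  have h := (Submodule.finrank_mono hle).trans (finrank_range_le_card _)
  rw [finrank_span_eq_card hli] at h
  simp only [Fintype.card_fun, Fintype.card_fin, Fintype.card_coe] at h
  exact (Nat.pow_le_pow_iff_right (by norm_num)).1 h

end

end UBQC

theorem proposition1 {V : Type*} [Fintype V] [DecidableEq V] (P : UBQC.Pattern V) :
    (∀ S : Finset P.Measured, 2 ≤ S.card →
      ¬ ∃ Λ : UBQC.Op (UBQC.Reg (Fin 1)) →ₗ[ℂ] UBQC.Op (UBQC.Reg {v : P.Measured // v ∈ S}),
        UBQC.IsChannel Λ ∧ ∃ C : UBQC.Client P S 1, C.Complete Λ ∧ C.Blind) ∧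
    (∀ (S : Finset P.Measured) (k : ℕ)
      (Λ : UBQC.Op (UBQC.Reg (Fin k)) →ₗ[ℂ] UBQC.Op (UBQC.Reg {v : P.Measured // v ∈ S}))
      (C : UBQC.Client P S k), UBQC.IsChannel Λ → C.Complete Λ → C.Blind →
        Fintype.card P.Measured ≤ C.qubitsSent) := by
  refine ⟨?_, fun S k Λ C hΛ hC hB => ?_⟩
  · rintro S hS ⟨Λ, hΛ, C, hC, hB⟩
    have := UBQC.Client.card_le hΛ hC hB
    omega
  · have h1 := UBQC.Client.card_le hΛ hC hB
    have h2 := Fintype.card_subtype_compl fun v : P.Measured => v ∈ S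
    have h3 : Fintype.card {v : P.Measured // v ∈ S} = S.card := by simp
    have h4 := S.card_le_univ
    rw [UBQC.Client.qubitsSent]
    omega
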